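/- Let $\mathfrak{gl}(1|1)[t]=\mathfrak{gl}(1|1)\otimes\mathbb C[t]$ be the complex current superalgebra with the pointwise supercommutator, with indices $1$ even and $2$ odd. Let $\mathrm U=\mathrm U(\mathfrak{gl}(1|1)[t])$ be its universal enveloping superalgebra, and write $e_{ij}[r]=e_{ij}\otimes t^r$ and $e_{ij}(x)=\sum_{r\ge 0}e_{ij}[r]\,x^{-r-1}\in \mathrm U((x^{-1}))$. For a ring $\mathscr A$ with a derivation $a\mapsto a'$, let $\mathscr A((\partial_x^{-1}))$ be the ring of pseudo-differential operators, with product determined by $\partial_x^r a=\sum_{s\ge 0}\binom rs a^{(s)}\partial_x^{r-s}$ for $r\in\mathbb Z$, $a\in\mathscr A$; here the derivation is $d/dx$. Define the Berezinian $$\mathfrak D(x,\partial_x)=\big(\partial_x-e_{11}(x)\big)\Big(\partial_x+e_{22}(x)+e_{21}(x)\big(\partial_x-e_{11}(x)\big)^{-1}e_{12}(x)\Big)^{-1}\in \mathrm U((x^{-1}))((\partial_x^{-1})),$$ and define the Gaudin transfer matrices $\mathcal G_r(x)\in\mathrm U((x^{-1}))$ by $\mathfrak D(x,\partial_x)=\sum_{r\ge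 0}(-1)^r\mathcal G_r(x)\,\partial_x^{-r}$. Then the two inverted operators are invertible, $\mathfrak D$ contains no positive powers of $\partial_x$, and $\mathcal G_0=1$. Let $\mathrm U_{\mathrm{loc}}$ be the localization of $\mathrm U$ at the powers of the central element $e_{11}[0]+e_{22}[0]$. The series $\mathcal G_1(x)$ is central in $\mathrm U((x^{-1}))$, the natural map $\mathrm U((x^{-1}))\to\mathrm U_{\mathrm{loc}}((x^{-1}))$ is injective, and $\mathcal G_1(x)$ is invertible in $\mathrm U_{\mathrm{loc}}((x^{-1}))$. In $\mathrm U_{\mathrm{loc}}((x^{-1}))((\partial_x^{-1}))$ the operator $\partial_x+\mathcal G_2(x)/\mathcal G_1(x)$ is invertible and $$\mathfrak D(x,\partial_x)=\Big(\partial_x-\mathcal G_1(x)+\frac{\mathcal G_2(x)}{\mathcal G_1(x)}\Big)\Big(\partial_x+\frac{\mathcal G_2(x)}{\mathcal G_1(x)}\Big)^{-1}.$$ Consequently all transfer matrices are expressed through the first two: for every $r\ge 0$, in $\mathrm U_{\mathrm{loc}}((x^{-1}))$, $$\mathcal G_{r+1}(x)=\mathcal G_1(x)\cdot\Big(\Big(\tfrac{d}{dx}+\tfrac{\mathcal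 G_2(x)}{\mathcal G_1(x)}\Big)^{r}\,1\Big).$$ -/

import Mathlib

namespace Gaudin

section
open Finset

/-- A derivation `∂` of a (not necessarily commutative) ring. -/
class DiffRing (A : Type*) [Ring A] where
  der : A →+ A
  leibniz : ∀ a b : A, der (a * b) = der a * b + a * der b

namespace DiffRing
variable {A : Type*} [Ring A] [DiffRing A]

lemma der_one : der (1 : A) = 0 := by
  have h := leibniz (1 : A) 1
  simpa using h

lemma iterate_sum {ι : Type*} (n : ℕ) (s : Finset ι) (f : ι → A) :
    (der : A →+ A)^[n] (∑ i ∈ s, f i) = ∑ i ∈ s, (der : A →+ A)^[n] (f i) := by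
  induction n with
  | zero => simp
  | succ n ih => simp [Function.iterate_succ_apply', ih]

lemma iterate_zsmul (n : ℕ) (z : ℤ) (a : A) :
    (der : A →+ A)^[n] (z • a) = z • (der : A →+ A)^[n] a := by
  induction n with
  | zero => simp only [Function.iterate_zero, id_eq]
  | succ n ih => simp only [Function.iterate_succ_apply', ih, map_zsmul]

lemma iterate_zero (n : ℕ) : (der : A →+ A)^[n] 0 = 0 := by
  induction n with
  | zero => simp
  | succ n ih => simp [Function.iterate_succ_apply', ih]

lemma iterate_add (n : ℕ) (a b : A) :
    (der : A →+ A)^[n] (a + b) = (der : A →+ A)^[n] a + (der : A →+ A)^[n] b := by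
  induction n with
  | zero => simp
  | succ n ih => simp [Function.iterate_succ_apply', ih]

lemma iterate_mul (n : ℕ) (a b : A) :
    (der : A →+ A)^[n] (a * b) = ∑ x ∈ antidiagonal n,
      (n.choose x.1) • ((der : A →+ A)^[x.1] a * (der : A →+ A)^[x.2] b) := by
  induction n with
  | zero => simp
  | succ n ih =>
    rw [sum_antidiagonal_choose_succ_nsmul
      (fun i j => (der : A →+ A)^[i] a * (der : A →+ A)^[j] b) n]
    simp only [Function.iterate_succ_apply', ih, map_sum, map_nsmul, leibniz, smul_add,
      sum_add_distrib]
    rw [add_comm]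
    congr 1
    refine sum_congr rfl fun x hx => ?_
    rw [n.choose_symm_of_eq_add (HasAntidiagonal.mem_antidiagonal.1 hx).symm]

end DiffRing

/-- Formal pseudo-differential operators `∑_{n ≤ N} a_n ∂^n` with coefficients in `A` written on the
left, i.e. Laurent series in `∂⁻¹`; the value at `n : ℤ` is the coefficient of `∂^n`. -/
def PDO.carrier (A : Type*) [Ring A] : AddSubgroup (ℤ → A) where
  carrier := {f | ∃ N : ℤ, ∀ n, N < n → f n = 0}
  zero_mem' := ⟨0, fun _ _ => rfl⟩
  add_mem' := by
    rintro f g ⟨N, hN⟩ ⟨M, hM⟩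
    refine ⟨max N M, fun n hn => ?_⟩
    simp [hN n (lt_of_le_of_lt (le_max_left _ _) hn), hM n (lt_of_le_of_lt (le_max_right _ _) hn)]
  neg_mem' := by
    rintro f ⟨N, hN⟩
    exact ⟨N, fun n hn => by simp [hN n hn]⟩

/-- The underlying additive group of `A((∂⁻¹))`. -/
def PDO (A : Type*) [Ring A] : Type _ := PDO.carrier A

namespace PDO

section
variable {A : Type*} [Ring A]

instance : AddCommGroup (PDO A) := inferInstanceAs (AddCommGroup (PDO.carrier A))

/-- The coefficient of `∂^n`. -/
def coeff (f : PDO A) (n : ℤ) : A := f.1 n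

lemma bdd (f : PDO A) : ∃ N : ℤ, ∀ n, N < n → f.coeff n = 0 := f.2

@[ext] lemma ext {f g : PDO A} (h : ∀ n, f.coeff n = g.coeff n) : f = g :=
  Subtype.ext (funext h)

/-- The series with the given coefficients. -/
def mk (f : ℤ → A) (h : ∃ N : ℤ, ∀ n, N < n → f n = 0) : PDO A := ⟨f, h⟩

@[simp] lemma coeff_mk (f : ℤ → A) (h) (n : ℤ) : (mk f h).coeff n = f n := rfl
@[simp] lemma coeff_add (f g : PDO A) (n : ℤ) : (f + g).coeff n = f.coeff n + g.coeff n := rfl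
@[simp] lemma coeff_neg (f : PDO A) (n : ℤ) : (-f).coeff n = -f.coeff n := rfl
@[simp] lemma coeff_sub (f g : PDO A) (n : ℤ) : (f - g).coeff n = f.coeff n - g.coeff n := rfl
@[simp] lemma coeff_zero (n : ℤ) : (0 : PDO A).coeff n = 0 := rfl

lemma exists_bdd₂ (f g : PDO A) :
    ∃ N : ℤ, (∀ n, N < n → f.coeff n = 0) ∧ ∀ n, N < n → g.coeff n = 0 := by
  obtain ⟨a, ha⟩ := f.bdd
  obtain ⟨b, hb⟩ := g.bdd
  exact ⟨max a b, fun n hn => ha n (by omega), fun n hn => hb n (by omega)⟩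

lemma eq_of_le {f g : PDO A} {a : ℤ} (hf : ∀ n, a < n → f.coeff n = 0)
    (hg : ∀ n, a < n → g.coeff n = 0) (h : ∀ N : ℕ, f.coeff (a - N) = g.coeff (a - N)) :
    f = g := by
  ext n
  by_cases hn : a < n
  · rw [hf n hn, hg n hn]
  · have := h (a - n).toNat
    rwa [show a - ((a - n).toNat : ℤ) = n by omega] at this

/-- The monomial `a ∂^r`. -/
def monomial (r : ℤ) (a : A) : PDO A :=
  mk (fun n => if n = r then a else 0) ⟨r, fun n hn => if_neg (by omega)⟩

@[simp] lemma coeff_monomial (r : ℤ) (a : A) (n : ℤ) :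
    (monomial r a).coeff n = if n = r then a else 0 := rfl

/-- An element `a` of `A` as the pseudo-differential operator `a ∂^0`. -/
def C (a : A) : PDO A := monomial 0 a

instance : One (PDO A) := ⟨C 1⟩

lemma one_def : (1 : PDO A) = C 1 := rfl

/-- The operator `∂`. -/
def del : PDO A := monomial 1 1

end

section
variable {A : Type*} [Ring A] [DiffRing A]
open DiffRing

/-- The coefficient of `∂^n` in the product `f g`, obtained by moving all powers of `∂` to the
right by the rule `∂^i b = ∑_s (i choose s) ∂^s(b) ∂^(i - s)`: it is the (finite) sum over `i ∈ ℤ`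
and `s ∈ ℕ` of `(i choose s) a_i ∂^s(b_j)` where `i + j - s = n`. -/
noncomputable def mulCoeff (f g : PDO A) (n : ℤ) : A :=
  ∑ᶠ p : ℤ × ℕ, (Ring.choose p.1 p.2 : ℤ) •
    (f.coeff p.1 * (der : A →+ A)^[p.2] (g.coeff (n - p.1 + p.2)))

lemma mulCoeff_eq_zero {f g : PDO A} {a b : ℤ} (hf : ∀ n, a < n → f.coeff n = 0)
    (hg : ∀ n, b < n → g.coeff n = 0) {n : ℤ} (hn : a + b < n) : mulCoeff f g n = 0 := by
  refine finsum_eq_zero_of_forall_eq_zero fun p => ?_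
  by_cases h : a < p.1
  · simp [hf _ h]
  · rw [hg _ (by omega)]; simp

lemma mulCoeff_eq_sum {f g : PDO A} {a b : ℤ} (hf : ∀ n, a < n → f.coeff n = 0)
    (hg : ∀ n, b < n → g.coeff n = 0) (N : ℕ) :
    mulCoeff f g (a + b - N) = ∑ x ∈ antidiagonal N, ∑ y ∈ antidiagonal x.2,
      (Ring.choose (a - x.1) y.2 : ℤ) •
        (f.coeff (a - x.1) * (der : A →+ A)^[y.2] (g.coeff (b - y.1))) := by
  classical
  rw [Finset.sum_sigma']
  set S := (antidiagonal N).sigma fun x : ℕ × ℕ => antidiagonal x.2 with hS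
  let e : (Σ _ : ℕ × ℕ, ℕ × ℕ) → ℤ × ℕ := fun x => (a - x.1.1, x.2.2)
  have he : Set.InjOn e S := by
    rintro ⟨⟨i, p⟩, ⟨j, s⟩⟩ h ⟨⟨i', p'⟩, ⟨j', s'⟩⟩ h' hh
    simp only [hS, coe_sigma, Set.mem_sigma_iff, mem_coe, HasAntidiagonal.mem_antidiagonal, e, Prod.mk.injEq] at *
    obtain ⟨rfl, rfl⟩ : i = i' ∧ s = s' := by omega
    obtain rfl : p = p' := by omega
    obtain rfl : j = j' := by omega
    rfl
  rw [mulCoeff, finsum_eq_sum_of_support_subset (s := S.image e), Finset.sum_image he]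
  · refine sum_congr rfl ?_
    rintro ⟨⟨i, p⟩, ⟨j, s⟩⟩ h
    simp only [hS, mem_sigma, HasAntidiagonal.mem_antidiagonal] at h
    simp only [e]
    rw [show a + b - (N : ℤ) - (a - i) + s = b - j by omega]
  · rintro ⟨i, s⟩ h
    rw [Function.mem_support] at h
    have h1 : i ≤ a := by
      by_contra h1
      exact h (by simp [hf i (by omega)])
    have h2 : a + b - N - i + s ≤ b := by
      by_contra h2
      exact h (by simp only []; rw [hg _ (by omega)]; simp)
    simp only [coe_image, Set.mem_image, mem_coe]
    refine ⟨⟨((a - i).toNat, N - (a - i).toNat), (N - (a - i).toNat - s, s)⟩, ?_, ?_⟩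
    · simp only [hS, mem_sigma, HasAntidiagonal.mem_antidiagonal]; omega
    · simp only [e, Prod.mk.injEq, and_true]; omega

noncomputable instance : Mul (PDO A) where
  mul f g := mk (mulCoeff f g) <| by
    obtain ⟨a, ha⟩ := f.bdd
    obtain ⟨b, hb⟩ := g.bdd
    exact ⟨a + b, fun n hn => mulCoeff_eq_zero ha hb hn⟩

lemma coeff_mul (f g : PDO A) (n : ℤ) : (f * g).coeff n =
    ∑ᶠ p : ℤ × ℕ, (Ring.choose p.1 p.2 : ℤ) •
      (f.coeff p.1 * (der : A →+ A)^[p.2] (g.coeff (n - p.1 + p.2))) := rfl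

lemma coeff_mul_eq_zero {f g : PDO A} {a b : ℤ} (hf : ∀ n, a < n → f.coeff n = 0)
    (hg : ∀ n, b < n → g.coeff n = 0) {n : ℤ} (hn : a + b < n) : (f * g).coeff n = 0 :=
  mulCoeff_eq_zero hf hg hn

lemma coeff_mul_eq_sum {f g : PDO A} {a b : ℤ} (hf : ∀ n, a < n → f.coeff n = 0)
    (hg : ∀ n, b < n → g.coeff n = 0) (N : ℕ) :
    (f * g).coeff (a + b - N) = ∑ x ∈ antidiagonal N, ∑ y ∈ antidiagonal x.2,
      (Ring.choose (a - x.1) y.2 : ℤ) •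
        (f.coeff (a - x.1) * (der : A →+ A)^[y.2] (g.coeff (b - y.1))) :=
  mulCoeff_eq_sum hf hg N

protected lemma left_distrib (f g h : PDO A) : f * (g + h) = f * g + f * h := by
  obtain ⟨a, ha⟩ := f.bdd
  obtain ⟨b, hb, hc⟩ := exists_bdd₂ g h
  have hbc : ∀ n, b < n → (g + h).coeff n = 0 := fun n hn => by simp [hb n hn, hc n hn]
  refine eq_of_le (a := a + b) (fun n hn => coeff_mul_eq_zero ha hbc hn)
    (fun n hn => by simp [coeff_mul_eq_zero ha hb hn, coeff_mul_eq_zero ha hc hn]) fun N => ?_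
  rw [coeff_add, coeff_mul_eq_sum ha hb, coeff_mul_eq_sum ha hc, coeff_mul_eq_sum ha hbc]
  simp [mul_add, smul_add, sum_add_distrib]

protected lemma right_distrib (f g h : PDO A) : (f + g) * h = f * h + g * h := by
  obtain ⟨a, ha, hb⟩ := exists_bdd₂ f g
  obtain ⟨c, hc⟩ := h.bdd
  have hab : ∀ n, a < n → (f + g).coeff n = 0 := fun n hn => by simp [ha n hn, hb n hn]
  refine eq_of_le (a := a + c) (fun n hn => coeff_mul_eq_zero hab hc hn)
    (fun n hn => by simp [coeff_mul_eq_zero ha hc hn, coeff_mul_eq_zero hb hc hn]) fun N => ?_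
  rw [coeff_add, coeff_mul_eq_sum ha hc, coeff_mul_eq_sum hb hc, coeff_mul_eq_sum hab hc]
  simp [add_mul, smul_add, sum_add_distrib]


protected lemma one_mul (g : PDO A) : 1 * g = g := by
  ext n
  rw [coeff_mul, finsum_eq_single _ (0, 0)]
  · simp [one_def, C]
  · rintro ⟨i, s⟩ h
    by_cases hi : i = 0
    · subst hi
      have hs : s ≠ 0 := fun hs => h (by rw [hs])
      simp [Ring.choose_zero_pos ℤ (Nat.pos_of_ne_zero hs)]
    · simp [one_def, C, hi]

protected lemma mul_one (g : PDO A) : g * 1 = g := by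
  ext n
  rw [coeff_mul, finsum_eq_single _ (n, 0)]
  · simp [one_def, C]
  · rintro ⟨i, s⟩ h
    by_cases hs : s = 0
    · subst hs
      have hi : n - i ≠ 0 := fun hi => h (by rw [sub_eq_zero.1 hi])
      simp [one_def, C, hi]
    · obtain ⟨s, rfl⟩ := Nat.exists_eq_succ_of_ne_zero hs
      simp only [one_def, C, coeff_monomial]
      split_ifs <;> simp [Function.iterate_succ_apply, der_one]

lemma choose_aux (x y : ℤ) (p r : ℕ) : Ring.choose x p * (Ring.choose (x - p) r * y)
    = Ring.choose x (p + r) * (((p + r).choose p : ℕ) * y) := by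
  have h := Ring.choose_smul_choose x (Nat.le_add_right p r)
  rw [Nat.add_sub_cancel_left, nsmul_eq_mul] at h
  linear_combination (-y) * h

protected lemma mul_assoc (f g h : PDO A) : f * g * h = f * (g * h) := by
  obtain ⟨a, ha⟩ := f.bdd
  obtain ⟨b, hb⟩ := g.bdd
  obtain ⟨c, hc⟩ := h.bdd
  have hab : ∀ n, a + b < n → (f * g).coeff n = 0 := fun n hn => coeff_mul_eq_zero ha hb hn
  have hbc : ∀ n, b + c < n → (g * h).coeff n = 0 := fun n hn => coeff_mul_eq_zero hb hc hn
  refine eq_of_le (a := a + b + c) (fun n hn => coeff_mul_eq_zero hab hc hn)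
    (fun n hn => coeff_mul_eq_zero ha hbc (by omega)) fun N => ?_
  rw [coeff_mul_eq_sum hab hc]
  rw [add_assoc, coeff_mul_eq_sum ha hbc]
  simp only [coeff_mul_eq_sum ha hb, coeff_mul_eq_sum hb hc, iterate_sum, iterate_zsmul,
    iterate_mul, mul_sum, sum_mul, smul_sum]
  have key : ∀ x ∈ antidiagonal N, ∀ y ∈ antidiagonal x.2, ∀ u ∈ antidiagonal x.1,
      ∀ v ∈ antidiagonal u.2,
      (Ring.choose (a + b - (x.1 : ℤ)) y.2 : ℤ) • ((Ring.choose (a - (u.1 : ℤ)) v.2 : ℤ) •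
        (f.coeff (a - u.1) * (der : A →+ A)^[v.2] (g.coeff (b - v.1))) *
          (der : A →+ A)^[y.2] (h.coeff (c - y.1))) =
      ∑ w ∈ antidiagonal y.2, (Ring.choose (a - (u.1 : ℤ)) (v.2 + w.1) *
        (((v.2 + w.1).choose v.2 : ℕ) * Ring.choose (b - (v.1 : ℤ)) w.2) : ℤ) •
        (f.coeff (a - u.1) * ((der : A →+ A)^[v.2] (g.coeff (b - v.1)) *
          (der : A →+ A)^[w.1 + w.2] (h.coeff (c - y.1)))) := by
    intro x hx y hy u hu v hv
    simp only [HasAntidiagonal.mem_antidiagonal] at hx hy hu hv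
    rw [show a + b - (x.1 : ℤ) = (a - u.1 - v.2) + (b - v.1) by omega,
      Ring.add_choose_eq _ (Commute.all _ _), sum_smul]
    refine sum_congr rfl fun w hw => ?_
    rw [HasAntidiagonal.mem_antidiagonal] at hw
    rw [← choose_aux, hw, smul_mul_assoc, smul_smul, mul_assoc (f.coeff _)]
    congr 1
    rw [mul_comm (_ * _) (Ring.choose (a - (u.1 : ℤ)) v.2)]
  rw [sum_congr rfl fun x hx => sum_congr rfl fun y hy => sum_congr rfl fun u hu =>
    sum_congr rfl fun v hv => key x hx y hy u hu v hv]
  simp only [sum_sigma']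
  refine sum_nbij'
    (fun z => ⟨(z.2.2.1.1, N - z.2.2.1.1),
      ⟨(z.2.2.2.1.1 + z.2.1.1 + z.2.2.2.2.2, z.2.2.2.1.2 + z.2.2.2.2.1),
      ⟨(z.2.2.2.1.1, z.2.1.1 + z.2.2.2.2.2), ⟨(z.2.1.1, z.2.2.2.2.2),
      (z.2.2.2.1.2, z.2.2.2.2.1)⟩⟩⟩⟩)
    (fun z => ⟨(z.1.1 + z.2.2.1.1 + z.2.2.2.2.1, z.2.2.2.1.1 + z.2.2.2.2.2 + z.2.2.2.1.2),
      ⟨(z.2.2.2.1.1, z.2.2.2.2.2 + z.2.2.2.1.2),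
      ⟨(z.1.1, z.2.2.1.1 + z.2.2.2.2.1), ⟨(z.2.2.1.1, z.2.2.2.2.1),
      (z.2.2.2.2.2, z.2.2.2.1.2)⟩⟩⟩⟩) ?_ ?_ ?_ ?_ ?_
  · rintro ⟨⟨x1, x2⟩, ⟨y1, y2⟩, ⟨u1, u2⟩, ⟨v1, v2⟩, ⟨w1, w2⟩⟩ hz
    simp only [mem_sigma, HasAntidiagonal.mem_antidiagonal, and_true] at hz ⊢
    omega
  · rintro ⟨⟨x1, x2⟩, ⟨y1, y2⟩, ⟨u1, u2⟩, ⟨v1, v2⟩, ⟨w1, w2⟩⟩ hz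
    simp only [mem_sigma, HasAntidiagonal.mem_antidiagonal, and_true] at hz ⊢
    omega
  · rintro ⟨⟨x1, x2⟩, ⟨y1, y2⟩, ⟨u1, u2⟩, ⟨v1, v2⟩, ⟨w1, w2⟩⟩ hz
    simp only [mem_sigma, HasAntidiagonal.mem_antidiagonal] at hz
    simp only [Sigma.mk.injEq, heq_eq_eq, Prod.mk.injEq, true_and, and_true]
    omega
  · rintro ⟨⟨x1, x2⟩, ⟨y1, y2⟩, ⟨u1, u2⟩, ⟨v1, v2⟩, ⟨w1, w2⟩⟩ hz
    simp only [mem_sigma, HasAntidiagonal.mem_antidiagonal] at hz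
    simp only [Sigma.mk.injEq, heq_eq_eq, Prod.mk.injEq, true_and, and_true]
    omega
  · rintro ⟨⟨x1, x2⟩, ⟨y1, y2⟩, ⟨u1, u2⟩, ⟨v1, v2⟩, ⟨w1, w2⟩⟩ hz
    simp only [mem_sigma, HasAntidiagonal.mem_antidiagonal] at hz
    obtain ⟨hx, hy, hu, hv, hw⟩ := hz
    simp only [← Function.iterate_add_apply, mul_smul_comm, mul_smul, Nat.cast_smul_eq_nsmul]
    rw [smul_comm ((v2 + w1).choose v2)]

noncomputable instance : Ring (PDO A) :=
  { (inferInstance : AddCommGroup (PDO A)) with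
    mul := (· * ·)
    one := 1
    left_distrib := PDO.left_distrib
    right_distrib := PDO.right_distrib
    zero_mul := fun f => by
      have h := PDO.right_distrib 0 0 f
      rwa [add_zero, left_eq_add] at h
    mul_zero := fun f => by
      have h := PDO.left_distrib f 0 0
      rwa [add_zero, left_eq_add] at h
    mul_assoc := PDO.mul_assoc
    one_mul := PDO.one_mul
    mul_one := PDO.mul_one }

end

/-- Coefficientwise application of a ring homomorphism. -/
def map {A B : Type*} [Ring A] [Ring B] (φ : A →+* B) (f : PDO A) : PDO B :=
  mk (fun n => φ (f.coeff n)) <| by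
    obtain ⟨N, hN⟩ := f.bdd
    exact ⟨N, fun n hn => by rw [hN n hn, map_zero]⟩

end PDO

end

/-! ### Laurent series in `x⁻¹` -/

/-- The ring `R((x⁻¹))`. It is the ring of Laurent series in a central variable standing for `x⁻¹`,
so that `f.coeff n` is the coefficient of `x^(-n)`. -/
def InvLaurent (R : Type*) [Ring R] : Type _ := LaurentSeries R

namespace InvLaurent
variable {R : Type*} [Ring R]

noncomputable instance : Ring (InvLaurent R) := inferInstanceAs (Ring (LaurentSeries R))

/-- The series `∑_n a_n x^(-n)` with coefficients vanishing for `n < N`. -/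
def mk (a : ℤ → R) (h : BddBelow (Function.support a)) : InvLaurent R :=
  HahnSeries.ofSuppBddBelow a h

/-- The coefficient of `x^(-n)`. -/
def coeff (f : InvLaurent R) (n : ℤ) : R := HahnSeries.coeff f n

/-- The Euler operator `-x d/dx`. -/
noncomputable def euler : LaurentSeries R →+ LaurentSeries R where
  toFun f := ⟨fun n => n • f.coeff n, f.isPWO_support.mono fun n hn h => hn (by
    simp only [h, smul_zero])⟩
  map_zero' := by ext; simp
  map_add' f g := by ext; simp

lemma coeff_euler (f : LaurentSeries R) (n : ℤ) : (euler f).coeff n = n • f.coeff n := rfl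

lemma support_euler (f : LaurentSeries R) : (euler f).support ⊆ f.support := fun n hn h =>
  hn (by simp only [coeff_euler, h, smul_zero])

lemma euler_mul (f g : LaurentSeries R) : euler (f * g) = euler f * g + f * euler g := by
  ext n
  rw [coeff_euler, HahnSeries.coeff_add, HahnSeries.coeff_mul,
    HahnSeries.coeff_mul_left' f.isPWO_support (support_euler f),
    HahnSeries.coeff_mul_right' g.isPWO_support (support_euler g), Finset.smul_sum,
    ← Finset.sum_add_distrib]
  refine Finset.sum_congr rfl fun x hx => ?_
  rw [Finset.mem_antidiagonal] at hx
  rw [coeff_euler, coeff_euler, ← hx.2.2, add_smul, smul_mul_assoc, mul_smul_comm]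

lemma single_mul_comm (f : LaurentSeries R) :
    HahnSeries.single (1 : ℤ) (1 : R) * f = f * HahnSeries.single (1 : ℤ) (1 : R) := by
  ext n
  obtain ⟨m, rfl⟩ : ∃ m, n = m + 1 := ⟨n - 1, by ring⟩
  rw [HahnSeries.coeff_single_mul_add, HahnSeries.coeff_mul_single_add, one_mul, mul_one]

/-- The derivation `∂_x = d/dx` of `R((x⁻¹))`, equal to `x⁻¹ (x d/dx)`. -/
noncomputable def ddx : LaurentSeries R →+ LaurentSeries R where
  toFun f := -(HahnSeries.single (1 : ℤ) (1 : R) * euler f)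
  map_zero' := by simp
  map_add' f g := by rw [map_add, mul_add, neg_add]

/-- `∂_x x^(-m) = -m x^(-m-1)`. -/
lemma coeff_ddx (f : LaurentSeries R) (m : ℤ) :
    (ddx f).coeff (m + 1) = -(m • f.coeff m) := by
  change -((HahnSeries.single (1 : ℤ) (1 : R) * euler f).coeff (m + 1)) = _
  rw [HahnSeries.coeff_single_mul_add, one_mul, coeff_euler]

lemma ddx_mul (f g : LaurentSeries R) : ddx (f * g) = ddx f * g + f * ddx g := by
  change -(HahnSeries.single (1 : ℤ) (1 : R) * euler (f * g)) =
    -(HahnSeries.single (1 : ℤ) (1 : R) * euler f) * g +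
      f * -(HahnSeries.single (1 : ℤ) (1 : R) * euler g)
  rw [euler_mul, mul_add, neg_add, neg_mul, mul_assoc, mul_neg, ← mul_assoc f,
    ← single_mul_comm f, mul_assoc]

noncomputable instance : DiffRing (InvLaurent R) where
  der := (ddx : LaurentSeries R →+ LaurentSeries R)
  leibniz := ddx_mul

/-- Coefficientwise application of a ring homomorphism, as a ring homomorphism. -/
noncomputable def map {S : Type*} [Ring S] (φ : R →+* S) : InvLaurent R →+* InvLaurent S where
  toFun f := HahnSeries.map (f : LaurentSeries R) φ
  map_one' := by
    change HahnSeries.map (1 : LaurentSeries R) φ = (1 : LaurentSeries S)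
    ext n
    rw [HahnSeries.map_coeff, HahnSeries.coeff_one, HahnSeries.coeff_one]
    split_ifs <;> simp
  map_zero' := by
    change HahnSeries.map (0 : LaurentSeries R) φ = (0 : LaurentSeries S)
    ext n
    simp
  map_mul' f g := HahnSeries.map_mul (φ : R →ₙ+* S)
  map_add' f g := by
    refine HahnSeries.ext (funext fun n => ?_)
    exact map_add φ (HahnSeries.coeff f n) (HahnSeries.coeff g n)

end InvLaurent

/-! ### The current superalgebra `gl(1|1)[t]` and its universal enveloping algebra -/

open Polynomial in
/-- The underlying space of `gl(1|1)[t]`: `2 × 2` matrices of polynomials in `t`. The indices `0`, `1`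
stand for the even and the odd basis vector of the superspace of dimension `1|1`. -/
abbrev Current : Type := Matrix (Fin 2) (Fin 2) ℂ[X]

/-- `X` is homogeneous of parity `p`: the matrix unit `E_ij` has parity `|i| + |j|`. -/
def IsHomogeneous (p : ZMod 2) (X : Current) : Prop :=
  ∀ i j : Fin 2, X i j ≠ 0 → ((i.val + j.val : ℕ) : ZMod 2) = p

/-- The sign `(-1)^(p q)`. -/
def sgn (p q : ZMod 2) : ℂ := (-1) ^ (p.val * q.val)

/-- The pointwise supercommutator `[X, Y] = X Y - (-1)^(p q) Y X` of elements of parities `p`, `q`. -/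
noncomputable def superBracket (p q : ZMod 2) (X Y : Current) : Current :=
  X * Y - sgn p q • (Y * X)

/-- The defining relations `X Y = (-1)^(|X||Y|) Y X + [X, Y]` of the enveloping superalgebra. -/
inductive EnvRel : TensorAlgebra ℂ Current → TensorAlgebra ℂ Current → Prop
  | comm (p q : ZMod 2) (X Y : Current) (hX : IsHomogeneous p X) (hY : IsHomogeneous q Y) :
      EnvRel (TensorAlgebra.ι ℂ X * TensorAlgebra.ι ℂ Y)
        (sgn p q • (TensorAlgebra.ι ℂ Y * TensorAlgebra.ι ℂ X) +
          TensorAlgebra.ι ℂ (superBracket p q X Y))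

/-- The universal enveloping superalgebra `U(gl(1|1)[t])`. -/
def U : Type := RingQuot EnvRel

noncomputable instance : Ring U := inferInstanceAs (Ring (RingQuot EnvRel))
noncomputable instance : Algebra ℂ U := inferInstanceAs (Algebra ℂ (RingQuot EnvRel))

/-- The quotient map from the tensor algebra. -/
noncomputable def mkU : TensorAlgebra ℂ Current →ₐ[ℂ] U := RingQuot.mkAlgHom ℂ EnvRel

lemma mkU_surjective : Function.Surjective mkU := RingQuot.mkAlgHom_surjective ℂ EnvRel

/-- The canonical map `gl(1|1)[t] → U(gl(1|1)[t])`. -/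
noncomputable def toU : Current →ₗ[ℂ] U := mkU.toLinearMap ∘ₗ TensorAlgebra.ι ℂ

lemma toU_mul (p q : ZMod 2) (X Y : Current) (hX : IsHomogeneous p X) (hY : IsHomogeneous q Y) :
    toU X * toU Y = sgn p q • (toU Y * toU X) + toU (superBracket p q X Y) := by
  have h : mkU _ = mkU _ := RingQuot.mkAlgHom_rel ℂ (EnvRel.comm p q X Y hX hY)
  rw [map_mul, map_add, map_smul, map_mul] at h
  exact h

/-- The element `e_ij[r] = E_ij ⊗ t^r` of `U(gl(1|1)[t])`. -/
noncomputable def e (i j : Fin 2) (r : ℕ) : U := toU (Matrix.single i j (Polynomial.X ^ r))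

/-- The generating series `e_ij(x) = ∑_{r ≥ 0} e_ij[r] x^(-r-1)`. -/
noncomputable def eSeries (i j : Fin 2) : InvLaurent U :=
  InvLaurent.mk (fun n => if 1 ≤ n then e i j (n - 1).toNat else 0)
    ⟨1, fun n hn => by by_contra h; exact hn (if_neg h)⟩

/-! ### The Berezinian and the Gaudin transfer matrices -/

/-- The `2 × 2` matrix with entries `δ_ab ∂_x - (-1)^|a| e_ab(x)`. -/
noncomputable def Z : Matrix (Fin 2) (Fin 2) (PDO (InvLaurent U)) := fun a b =>
  (if a = b then PDO.del else 0) - PDO.C ((-1) ^ a.val * eSeries a b)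

/-- The `1|1` Berezinian `M₁₁ (M₂₂ - M₂₁ M₁₁⁻¹ M₁₂)⁻¹`. -/
noncomputable def ber {R : Type*} [Ring R] (M : Matrix (Fin 2) (Fin 2) R) : R :=
  M 0 0 * Ring.inverse (M 1 1 - M 1 0 * Ring.inverse (M 0 0) * M 0 1)

/-- `𝔇(x, ∂_x)`, the Berezinian of `Z`. -/
noncomputable def D : PDO (InvLaurent U) := ber Z

/-- The explicit form of the Berezinian. -/
lemma D_eq : D = (PDO.del - PDO.C (eSeries 0 0)) *
    Ring.inverse (PDO.del + PDO.C (eSeries 1 1) + PDO.C (eSeries 1 0) *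
      Ring.inverse (PDO.del - PDO.C (eSeries 0 0)) * PDO.C (eSeries 0 1)) := by
  have h : ∀ a : InvLaurent U, PDO.C (-a) = -PDO.C a := fun a => by
    ext n
    by_cases hn : n = 0 <;> simp [PDO.C, hn]
  simp [D, ber, Z, h]

/-- The transfer matrices: `𝔇(x, ∂_x) = ∑_{r ≥ 0} (-1)^r G_r(x) ∂_x^(-r)`. -/
noncomputable def G (r : ℕ) : InvLaurent U := (-1) ^ r * D.coeff (-r)

/-! ### Inverting `e_11[0] + e_22[0]` -/

/-- The central element `e_11[0] + e_22[0]`, the leading coefficient of `e_11(x) + e_22(x)`. -/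
noncomputable def c₀ : U := e 0 0 0 + e 1 1 0

lemma c₀_eq : c₀ = toU 1 := by
  rw [c₀, e, e, ← map_add]
  congr 1
  ext i j : 2
  fin_cases i <;> fin_cases j <;> simp

lemma c₀_comm_toU (Y : Current) : c₀ * toU Y = toU Y * c₀ := by
  have hom1 : IsHomogeneous 0 (1 : Current) := fun i j h => by
    fin_cases i <;> fin_cases j <;> first | rfl | simp at h
  have key : ∀ (q : ZMod 2) (Y : Current), IsHomogeneous q Y → c₀ * toU Y = toU Y * c₀ := by
    intro q Y hY
    rw [c₀_eq, toU_mul 0 q 1 Y hom1 hY]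
    simp [sgn, superBracket]
  have hY : Y = !![Y 0 0, 0; 0, Y 1 1] + !![0, Y 0 1; Y 1 0, 0] := by
    ext i j : 2
    fin_cases i <;> fin_cases j <;> simp
  rw [hY, map_add, mul_add, add_mul, key 0, key 1]
  · intro i j h
    fin_cases i <;> fin_cases j <;> first | rfl | simp at h
  · intro i j h
    fin_cases i <;> fin_cases j <;> first | rfl | simp at h

lemma c₀_central (u : U) : c₀ * u = u * c₀ := by
  obtain ⟨v, rfl⟩ := mkU_surjective u
  induction v using TensorAlgebra.induction with
  | algebraMap r =>
    rw [AlgHom.commutes]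
    exact (Algebra.commutes r c₀).symm
  | ι x => exact c₀_comm_toU x
  | mul a b ha hb => rw [map_mul, ← mul_assoc, ha, mul_assoc, hb, mul_assoc]
  | add a b ha hb => rw [map_add, mul_add, add_mul, ha, hb]

lemma powers_central (s : Submonoid.powers c₀) (u : U) : (s : U) * u = u * s := by
  obtain ⟨s, n, rfl⟩ := s
  exact ((show Commute c₀ u from c₀_central u).pow_left n).eq

noncomputable instance : OreLocalization.OreSet (Submonoid.powers c₀) where
  ore_right_cancel a b s h := ⟨s, by rw [powers_central, powers_central, h]⟩
  oreNum a _ := a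
  oreDenom _ s := s
  ore_eq a s := powers_central s a

/-- The localization of `U(gl(1|1)[t])` at the powers of the central element `e_11[0] + e_22[0]`. -/
abbrev ULoc : Type := OreLocalization (Submonoid.powers c₀) U

/-- The canonical map from `U(gl(1|1)[t])((x⁻¹))` to the Laurent series over the localization. -/
noncomputable def loc : InvLaurent U →+* InvLaurent ULoc :=
  InvLaurent.map OreLocalization.numeratorRingHom

/-- The quotient `G_2(x) / G_1(x)`, a Laurent series in `x⁻¹` over the localization. -/
noncomputable def ratio : InvLaurent ULoc := loc (G 2) * Ring.inverse (loc (G 1))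

end Gaudin

open Gaudin

/-! Write `a = e_11(x)`, `b = e_22(x)`, `E = e_12(x)`, `F = e_21(x)`, `h = a + b`, `P = ∂ - a`, and
let `K = ∂ + b + F P⁻¹ E` be the operator inverted in the Berezinian. The current relations, taken
at one point `x`, say that `h` is central, `aF - Fa = F'`, `EF + FE = -h'` and `F² = 0`. Nothing
else about `gl(1|1)` enters the factorization.

Once `h` is invertible, these relations give `P · h⁻¹F = h⁻¹F · Q` with `Q = P + h⁻¹EF`
(`PDO.del_sub_mul_C`). Put `W = 1 - h⁻¹F Q⁻¹ E`. Then `P W = P - h⁻¹FE`, while the resolvent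
identity for `P` and `Q` gives `(h + F P⁻¹ E) W = h`. Since `K = P + (h + F P⁻¹ E)`, it follows that
`K W = ∂ + ρ` with `ρ = b - h⁻¹FE`, and hence `P K⁻¹ (∂ + ρ) = P W = ∂ - h + ρ`
(`PDO.berezinian_mul`).

So the Berezinian is `1 - h (∂ + ρ)⁻¹`, and `(∂ + ρ)⁻¹ = ∑ (-1)^r ((d + ρ)^r 1) ∂^(-r-1)`. Comparing
coefficients gives `G_{r+1} = h · (d + ρ)^r 1`. In particular `G_1 = h` and `G_2 = hρ`, which
identifies `ρ` with `G_2 / G_1`.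

The computation takes place over the localization and descends to `U` because `c₀` is not a zero
divisor (`eq_zero_of_mul_c₀_eq_zero`). No basis of `U` is needed for that: tensoring `U` with a
two-dimensional module on which the identity matrix acts by a variable `λ` makes `c₀` act by the
monic polynomial `λ + c₀`, and setting `λ = 0` recovers `U`. -/

lemma isUnit_of_isUnit_mul_of_isUnit {R : Type*} [Monoid R] {a u : R} (h : IsUnit (a * u))
    (hu : IsUnit u) : IsUnit a := by
  obtain ⟨u, rfl⟩ := hu
  simpa using h

namespace Gaudin

open DiffRing Finset

/-! ### Coefficients, orders and elementary products of pseudo-differential operators. -/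

namespace PDO

section Basic
variable {A : Type*} [Ring A]

lemma coeff_one (n : ℤ) : (1 : PDO A).coeff n = if n = 0 then 1 else 0 := rfl

lemma coeff_C (a : A) (n : ℤ) : (C a).coeff n = if n = 0 then a else 0 := rfl

lemma coeff_del (n : ℤ) : (del : PDO A).coeff n = if n = 1 then 1 else 0 := rfl

lemma C_neg (a : A) : C (-a) = -C a := by
  ext n
  by_cases hn : n = 0 <;> simp [coeff_C, hn]

lemma C_add (a b : A) : C (a + b) = C a + C b := by
  ext n
  by_cases hn : n = 0 <;> simp [coeff_C, hn]

lemma C_sub (a b : A) : C (a - b) = C a - C b := by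
  rw [sub_eq_add_neg, C_add, C_neg, ← sub_eq_add_neg]

/-- The coefficients of `f` vanish above `∂^a`. -/
def OrderLE (a : ℤ) (f : PDO A) : Prop := ∀ n, a < n → f.coeff n = 0

lemma OrderLE.mono {a b : ℤ} {f : PDO A} (hf : OrderLE a f) (h : a ≤ b) : OrderLE b f :=
  fun n hn => hf n (by omega)

lemma orderLE_C (a : A) : OrderLE 0 (C a) := fun n hn => by rw [coeff_C, if_neg (by omega)]

lemma orderLE_del : OrderLE 1 (del : PDO A) := fun n hn => by rw [coeff_del, if_neg (by omega)]

lemma coeff_map {B : Type*} [Ring B] (φ : A →+* B) (f : PDO A) (n : ℤ) : (f.map φ).coeff n = φ (f.coeff n) := rfl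

end Basic

variable {A : Type*} [Ring A] [DiffRing A]

/-- Left multiplication by a function is coefficientwise. -/
lemma coeff_C_mul (a : A) (g : PDO A) (n : ℤ) : (C a * g).coeff n = a * g.coeff n := by
  rw [coeff_mul, finsum_eq_single _ (0, 0)]
  · simp [coeff_C]
  · rintro ⟨i, s⟩ h
    by_cases hi : i = 0
    · subst hi
      have hs : s ≠ 0 := fun hs => h (by rw [hs])
      simp [Ring.choose_zero_pos ℤ (Nat.pos_of_ne_zero hs)]
    · simp [coeff_C, hi]

lemma C_mul (a b : A) : C (a * b) = C a * C b := by
  ext n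
  rw [coeff_C_mul]
  by_cases hn : n = 0 <;> simp [coeff_C, hn]

lemma coeff_del_mul (g : PDO A) (n : ℤ) :
    (del * g).coeff n = g.coeff (n - 1) + der (g.coeff n) := by
  rw [coeff_mul, finsum_eq_sum_of_support_subset (s := {(1, 0), (1, 1)})]
  · rw [sum_pair (by simp)]
    simp [coeff_del]
  · rintro ⟨i, s⟩ h
    rw [Function.mem_support] at h
    by_cases hi : i = 1
    · subst hi
      have hs : s < 2 := by
        by_contra hs
        refine h ?_
        have : Ring.choose (1 : ℤ) s = 0 := by
          rw [show (1 : ℤ) = ((1 : ℕ) : ℤ) by simp, Ring.choose_natCast,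
            Nat.choose_eq_zero_of_lt (by omega)]
          simp
        simp [this]
      interval_cases s <;> simp
    · exact absurd (by simp [coeff_del, hi]) h

lemma coeff_mul_monomial (f : PDO A) (r n : ℤ) :
    (f * monomial r 1).coeff n = f.coeff (n - r) := by
  rw [coeff_mul, finsum_eq_single _ (n - r, 0)]
  · simp
  · rintro ⟨i, s⟩ h
    by_cases hs : s = 0
    · subst hs
      have hi : n - i ≠ r := fun hi => h (by rw [← hi]; simp)
      simp [hi]
    · obtain ⟨s, rfl⟩ := Nat.exists_eq_succ_of_ne_zero hs
      simp only [coeff_monomial]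
      split_ifs <;> simp [Function.iterate_succ_apply, der_one]

lemma monomial_mul_monomial (r s : ℤ) :
    (monomial r 1 * monomial s 1 : PDO A) = monomial (r + s) 1 := by
  ext n
  rw [coeff_mul_monomial, coeff_monomial, coeff_monomial]
  simp only [sub_eq_iff_eq_add]

lemma isUnit_monomial (r : ℤ) : IsUnit (monomial r 1 : PDO A) :=
  ⟨⟨monomial r 1, monomial (-r) 1, by rw [monomial_mul_monomial, add_neg_cancel]; rfl,
    by rw [monomial_mul_monomial, neg_add_cancel]; rfl⟩, rfl⟩

/-- The commutation rule `∂ a = a ∂ + a'`. -/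
lemma del_mul_C (a : A) : del * C a = C a * del + C (der a) := by
  ext n
  rw [coeff_del_mul, coeff_add, coeff_C_mul, coeff_C, coeff_C, coeff_C, coeff_del]
  by_cases h0 : n = 0
  · subst h0; simp
  · by_cases h1 : n = 1
    · subst h1; simp
    · simp [h0, h1, sub_eq_iff_eq_add]

/-! ### Invertibility of monic operators -/

lemma OrderLE.mul {a b : ℤ} {f g : PDO A} (hf : OrderLE a f) (hg : OrderLE b g) :
    OrderLE (a + b) (f * g) := fun _ hn => coeff_mul_eq_zero hf hg hn

lemma OrderLE.add {a : ℤ} {f g : PDO A} (hf : OrderLE a f) (hg : OrderLE a g) :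
    OrderLE a (f + g) := fun n hn => by rw [coeff_add, hf n hn, hg n hn, add_zero]

lemma OrderLE.sub {a : ℤ} {f g : PDO A} (hf : OrderLE a f) (hg : OrderLE a g) :
    OrderLE a (f - g) := fun n hn => by rw [coeff_sub, hf n hn, hg n hn, sub_zero]

lemma OrderLE.pow {f : PDO A} (hf : OrderLE (-1) f) (k : ℕ) : OrderLE (-k) (f ^ k) := by
  induction k with
  | zero => simpa using! orderLE_C (1 : A)
  | succ k ih =>
    rw [pow_succ]
    exact (ih.mul hf).mono (by push_cast; omega)

lemma coeff_sum {ι : Type*} (s : Finset ι) (f : ι → PDO A) (n : ℤ) :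
    (∑ i ∈ s, f i).coeff n = ∑ i ∈ s, (f i).coeff n := by
  classical
  induction s using Finset.induction_on with
  | empty => simp
  | insert i s hi ih => rw [sum_insert hi, sum_insert hi, coeff_add, ih]

/-- The geometric series `∑_k f^k` of an operator of negative order. -/
noncomputable def geom (f : PDO A) (hf : OrderLE (-1) f) : PDO A :=
  -- `f ^ k` has order at most `-k`, so only the powers with `k ≤ -n` reach `∂^n` and the truncation
  -- is exact.
  mk (fun n => (∑ k ∈ range ((-n).toNat + 1), f ^ k).coeff n) <| by
    refine ⟨0, fun n hn => ?_⟩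
    rw [coeff_sum]
    exact sum_eq_zero fun k _ => hf.pow k n (by omega)

lemma orderLE_geom_sub (f : PDO A) (hf : OrderLE (-1) f) (M : ℕ) :
    OrderLE (-M) (geom f hf - ∑ k ∈ range (M + 1), f ^ k) := by
  intro n hn
  rw [coeff_sub, sub_eq_zero]
  change (∑ k ∈ range ((-n).toNat + 1), f ^ k).coeff n = _
  rw [coeff_sum, coeff_sum]
  refine sum_subset (fun k hk => ?_) fun k _ hk => ?_
  · rw [mem_range] at *; omega
  · rw [mem_range] at hk
    exact hf.pow k n (by omega)

lemma eq_zero_of_forall_orderLE {f : PDO A} (h : ∀ M : ℕ, OrderLE (-M) f) : f = 0 := by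
  ext n
  exact h ((-n).toNat + 1) n (by push_cast; omega)

/-- The inverse is the geometric series. Replacing it by its partial sum changes each product only
in order `≤ -M` and leaves the remainder `f ^ (M + 1)`; since `M` is arbitrary, the error vanishes.
-/
lemma isUnit_one_sub {f : PDO A} (hf : OrderLE (-1) f) : IsUnit (1 - f) := by
  have h1 : OrderLE 0 (1 - f) := (orderLE_C 1).sub (hf.mono (by norm_num))
  refine ⟨⟨1 - f, geom f hf, ?_, ?_⟩, rfl⟩
  · rw [← sub_eq_zero]
    refine eq_zero_of_forall_orderLE fun M => ?_
    have : (1 - f) * geom f hf - 1 =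
        (1 - f) * (geom f hf - ∑ k ∈ range (M + 1), f ^ k) - f ^ (M + 1) := by
      rw [mul_sub, mul_neg_geom_sum]; abel
    rw [this]
    exact ((h1.mul (orderLE_geom_sub f hf M)).mono (by omega)).sub ((hf.pow (M + 1)).mono (by push_cast; omega))
  · rw [← sub_eq_zero]
    refine eq_zero_of_forall_orderLE fun M => ?_
    have : geom f hf * (1 - f) - 1 =
        (geom f hf - ∑ k ∈ range (M + 1), f ^ k) * (1 - f) - f ^ (M + 1) := by
      rw [sub_mul, geom_sum_mul_neg]; abel
    rw [this]
    exact (((orderLE_geom_sub f hf M).mul h1).mono (by omega)).sub ((hf.pow (M + 1)).mono (by push_cast; omega))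

/-- An operator `∂ + (order ≤ 0)` is invertible. -/
lemma isUnit_del_add {f : PDO A} (hf : OrderLE 0 f) : IsUnit (del + f) := by
  refine isUnit_of_isUnit_mul_of_isUnit (u := monomial (-1) 1) ?_ (isUnit_monomial _)
  -- Dividing by `∂` on the right lowers every order by one, so `f` becomes an operator of negative
  -- order.
  have h : (del + f) * monomial (-1) 1 = 1 - -(f * monomial (-1) 1) := by
    rw [sub_neg_eq_add, add_mul, del, monomial_mul_monomial]
    rfl
  rw [h]
  refine isUnit_one_sub fun n hn => ?_
  rw [coeff_neg, coeff_mul_monomial, hf _ (by omega), neg_zero]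

/-! ### The inverse of `∂ + ρ` -/

/-- The operator `∑_r (-1)^r ((d + ρ)^r 1) ∂^(-r-1)`. -/
def delAddInv (ρ : A) : PDO A :=
  mk (fun n => if n < 0 then
    (-1) ^ (-n - 1).toNat * (fun h => der h + ρ * h)^[(-n - 1).toNat] 1 else 0)
    ⟨0, fun _ hn => if_neg (by omega)⟩

lemma orderLE_delAddInv (ρ : A) : OrderLE (-1) (delAddInv ρ) := fun _ hn => if_neg (by omega)

lemma coeff_delAddInv (ρ : A) (r : ℕ) : (delAddInv ρ).coeff (-(r : ℤ) - 1) =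
    (-1) ^ r * (fun h => der h + ρ * h)^[r] 1 := by
  change (if _ then _ else _) = _
  rw [if_pos (by omega), show (-(-(r : ℤ) - 1) - 1).toNat = r by omega]

lemma der_neg_one_pow_mul (r : ℕ) (a : A) : der ((-1) ^ r * a) = (-1) ^ r * der a := by
  rcases Nat.even_or_odd r with h | h <;> simp [h.neg_one_pow]

/-- The coefficient `b_r` of `∂^(-r-1)` satisfies `b_0 = 1` and `b_{r+1} = -(b_r' + ρ b_r)`, which
is exactly the vanishing of the product below `∂^0`. -/
lemma del_add_mul_delAddInv (ρ : A) : (del + C ρ) * delAddInv ρ = 1 := by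
  refine eq_of_le (a := 0) (fun n hn => ?_) (orderLE_C 1) fun N => ?_
  · exact ((orderLE_del.add ((orderLE_C ρ).mono (by omega))).mul
      (orderLE_delAddInv ρ)) n (by omega)
  · rw [add_mul, coeff_add, coeff_del_mul, coeff_C_mul, coeff_one]
    rcases N with _ | N
    · have h0 := orderLE_delAddInv ρ 0 (by omega)
      have h1 := coeff_delAddInv ρ 0
      simp only [Nat.cast_zero, neg_zero, pow_zero, one_mul, Function.iterate_zero, id] at h1
      rw [zero_sub] at h1
      simp [h0, h1]
    · rw [show (0 : ℤ) - ((N + 1 : ℕ) : ℤ) - 1 = -((N + 1 : ℕ) : ℤ) - 1 by omega,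
        show (0 : ℤ) - ((N + 1 : ℕ) : ℤ) = -(N : ℤ) - 1 by push_cast; ring,
        coeff_delAddInv, coeff_delAddInv, der_neg_one_pow_mul, Function.iterate_succ_apply',
        if_neg (by omega), pow_succ]
      have hc : ρ * ((-1) ^ N * (fun h => der h + ρ * h)^[N] 1) =
          (-1) ^ N * (ρ * (fun h => der h + ρ * h)^[N] 1) := by
        rw [← mul_assoc, ← mul_assoc, ((Commute.neg_one_left ρ).pow_left N).eq]
      rw [hc]
      noncomm_ring

/-- Invertibility is already known, so a right inverse is the inverse. -/
lemma inverse_del_add (ρ : A) : Ring.inverse (del + C ρ) = delAddInv ρ := by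
  have h : IsUnit (del + C ρ) := isUnit_del_add (orderLE_C ρ)
  have h2 := Ring.inverse_mul_cancel _ h
  calc Ring.inverse (del + C ρ)
      = Ring.inverse (del + C ρ) * ((del + C ρ) * delAddInv ρ) := by
        rw [del_add_mul_delAddInv, mul_one]
    _ = delAddInv ρ := by rw [← mul_assoc, h2, one_mul]

/-! ### Functoriality -/

variable {B : Type*} [Ring B] [DiffRing B]

/-- Coefficientwise application of a homomorphism of differential rings, as a ring
homomorphism. -/
noncomputable def mapHom (φ : A →+* B) (hφ : ∀ a, φ (der a) = der (φ a)) : PDO A →+* PDO B where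
  toFun := map φ
  map_one' := by
    ext n
    rw [coeff_map, coeff_one, coeff_one]
    split_ifs <;> simp
  map_zero' := by
    ext n
    simp [coeff_map]
  map_add' f g := by
    ext n
    simp [coeff_map]
  map_mul' f g := by
    obtain ⟨a, ha⟩ := f.bdd
    obtain ⟨b, hb⟩ := g.bdd
    have ha' : ∀ n, a < n → (f.map φ).coeff n = 0 := fun n hn => by
      rw [coeff_map, ha n hn, map_zero]
    have hb' : ∀ n, b < n → (g.map φ).coeff n = 0 := fun n hn => by
      rw [coeff_map, hb n hn, map_zero]
    have hit : ∀ (s : ℕ) (x : A), φ ((der : A →+ A)^[s] x) = (der : B →+ B)^[s] (φ x) := by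
      intro s x
      induction s with
      | zero => rfl
      | succ s ih => rw [Function.iterate_succ_apply', Function.iterate_succ_apply', hφ, ih]
    refine eq_of_le (a := a + b) (fun n hn => ?_) (fun n hn => coeff_mul_eq_zero ha' hb' hn)
      fun N => ?_
    · rw [coeff_map, coeff_mul_eq_zero ha hb hn, map_zero]
    · rw [coeff_map, coeff_mul_eq_sum ha hb, coeff_mul_eq_sum ha' hb']
      simp only [map_sum, map_zsmul, map_mul, hit, coeff_map]

lemma mapHom_apply (φ : A →+* B) (hφ : ∀ a, φ (der a) = der (φ a)) (f : PDO A) :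
    mapHom φ hφ f = f.map φ := rfl

lemma mapHom_C (φ : A →+* B) (hφ : ∀ a, φ (der a) = der (φ a)) (a : A) :
    mapHom φ hφ (C a) = C (φ a) := by
  ext n
  rw [mapHom_apply, coeff_map, coeff_C, coeff_C]
  split_ifs <;> simp

lemma mapHom_del (φ : A →+* B) (hφ : ∀ a, φ (der a) = der (φ a)) :
    mapHom φ hφ del = del := by
  ext n
  rw [mapHom_apply, coeff_map, coeff_del, coeff_del]
  split_ifs <;> simp

end PDO

/-- `Ring.inverse` is `0` off the units, and a non-unit may become a unit under `φ`; hence the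
hypothesis. -/
lemma map_ringInverse {R S : Type*} [Ring R] [Ring S] (φ : R →+* S) {x : R} (hx : IsUnit x) :
    φ (Ring.inverse x) = Ring.inverse (φ x) := by
  obtain ⟨u, rfl⟩ := hx
  rw [Ring.inverse_unit, show φ (u : R) = (Units.map (φ : R →* S) u : S) from rfl,
    Ring.inverse_unit]
  rfl

/-! ### The enveloping algebra: centrality and regularity of `c₀` -/

/-- The even part of an element of `gl(1|1)[t]`. -/
noncomputable def evenPart : Current →ₗ[ℂ] Current where
  toFun X := !![X 0 0, 0; 0, X 1 1]
  map_add' X Y := by ext i j : 1; fin_cases i <;> fin_cases j <;> simp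
  map_smul' c X := by ext i j : 1; fin_cases i <;> fin_cases j <;> simp

/-- The odd part of an element of `gl(1|1)[t]`. -/
noncomputable def oddPart : Current →ₗ[ℂ] Current where
  toFun X := !![0, X 0 1; X 1 0, 0]
  map_add' X Y := by ext i j : 1; fin_cases i <;> fin_cases j <;> simp
  map_smul' c X := by ext i j : 1; fin_cases i <;> fin_cases j <;> simp

lemma evenPart_add_oddPart (X : Current) : evenPart X + oddPart X = X := by
  ext i j : 1; fin_cases i <;> fin_cases j <;> simp [evenPart, oddPart]

open Polynomial in
/-- The value at `t = 0`. -/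
noncomputable def atZero : Current →+* Matrix (Fin 2) (Fin 2) ℂ :=
  (Polynomial.constantCoeff : ℂ[X] →+* ℂ).mapMatrix

/-- The action of a homogeneous element, with matrix `(y i j)` at `t = 0`, on `V ⊗ R`: here `V` is
the two-dimensional module of `gl(1|1)` on which the identity matrix acts by the central parameter
`x`, and `u`, `v` are the actions of the even and the odd part on `R`. -/
def twist {R : Type*} [Ring R] [Algebra ℂ R] (x u v : R) (y : Matrix (Fin 2) (Fin 2) ℂ) :
    Matrix (Fin 2) (Fin 2) R :=
  -- The sign of `v` in the second diagonal entry makes `diag(v, -v)` anticommute with the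
  -- off-diagonal action, as the tensor product of supermodules requires. At `x = 0` the first row
  -- becomes `(u + v, 0)`: the trivial module is then a quotient of `V`.
  !![u + v + y 1 1 • x, y 0 1 • x; y 1 0 • 1, u - v + y 1 1 • x + (y 1 1 - y 0 0) • 1]

section Twist

variable {R : Type*} [Ring R] [Algebra ℂ R] {x u v w : R}

lemma twist_add (u v u' v' : R) (y z : Matrix (Fin 2) (Fin 2) ℂ) :
    twist x (u + u') (v + v') (y + z) = twist x u v y + twist x u' v' z := by
  ext i j : 1
  fin_cases i <;> fin_cases j <;> simp [twist] <;> module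

lemma twist_smul (c : ℂ) (u v : R) (y : Matrix (Fin 2) (Fin 2) ℂ) :
    twist x (c • u) (c • v) (c • y) = c • twist x u v y := by
  ext i j : 1
  fin_cases i <;> fin_cases j <;> simp [twist] <;> module

lemma twist_even_even (hu : Commute x u) (hv : Commute x v) (h : u * v = v * u) (a b c d : ℂ) :
    twist x u 0 !![a, 0; 0, b] * twist x v 0 !![c, 0; 0, d] =
      twist x v 0 !![c, 0; 0, d] * twist x u 0 !![a, 0; 0, b] := by
  ext i j : 1
  fin_cases i <;> fin_cases j <;>
    simp [twist, Matrix.mul_apply, Fin.sum_univ_two, mul_add, add_mul, h, hu.eq, hv.eq] <;> module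

lemma twist_even_odd (hu : Commute x u) (hv : Commute x v) (h : u * v = v * u + w)
    (a b c d : ℂ) :
    twist x u 0 !![a, 0; 0, b] * twist x 0 v !![0, c; d, 0] =
      twist x 0 v !![0, c; d, 0] * twist x u 0 !![a, 0; 0, b] +
        twist x 0 w !![0, (a - b) * c; (b - a) * d, 0] := by
  ext i j : 1
  fin_cases i <;> fin_cases j <;>
    simp [twist, Matrix.mul_apply, Fin.sum_univ_two, mul_add, add_mul, h, hu.eq, hv.eq] <;> module

/-- The mixed terms cancel by the sign of the odd part. The off-diagonal matrices alone give the
scalar `(a d + b c) x`, which is the action of the bracket because its two diagonal entries agree.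
-/
lemma twist_odd_odd (hu : Commute x u) (hv : Commute x v) (h : u * v = -(v * u) + w)
    (a b c d : ℂ) :
    twist x 0 u !![0, a; b, 0] * twist x 0 v !![0, c; d, 0] =
      -(twist x 0 v !![0, c; d, 0] * twist x 0 u !![0, a; b, 0]) +
        twist x w 0 !![a * d + b * c, 0; 0, a * d + b * c] := by
  ext i j : 1
  fin_cases i <;> fin_cases j <;>
    simp [twist, Matrix.mul_apply, Fin.sum_univ_two, h, hu.eq, hv.eq] <;> module

end Twist

lemma isHomogeneous_zero_iff (Y : Current) : IsHomogeneous 0 Y ↔ oddPart Y = 0 := by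
  constructor
  · intro h
    have h1 := h 0 1
    have h2 := h 1 0
    simp only [Fin.val_zero, Fin.val_one, zero_add, add_zero, Nat.cast_one, one_ne_zero,
      imp_false, not_not] at h1 h2
    ext i j : 1; fin_cases i <;> fin_cases j <;> simp [oddPart, h1, h2]
  · intro h i j hij
    have h1 := congr_fun (congr_fun h 0) 1
    have h2 := congr_fun (congr_fun h 1) 0
    simp [oddPart] at h1 h2
    fin_cases i <;> fin_cases j <;> first | rfl | simp_all

lemma isHomogeneous_one_iff (Y : Current) : IsHomogeneous 1 Y ↔ evenPart Y = 0 := by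
  constructor
  · intro h
    have h1 := h 0 0
    have h2 := h 1 1
    have h11 : ((1 + 1 : ℕ) : ZMod 2) = 0 := rfl
    simp only [Fin.val_zero, Fin.val_one, add_zero, Nat.cast_zero, h11, zero_ne_one,
      imp_false, not_not] at h1 h2
    ext i j : 1; fin_cases i <;> fin_cases j <;> simp [evenPart, h1, h2]
  · intro h i j hij
    have h1 := congr_fun (congr_fun h 0) 0
    have h2 := congr_fun (congr_fun h 1) 1
    simp [evenPart] at h1 h2
    fin_cases i <;> fin_cases j <;> first | rfl | simp_all

lemma atZero_smul (c : ℂ) (Y : Current) : atZero (c • Y) = c • atZero Y := by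
  ext i j : 1
  simp [atZero]

open Polynomial in
/-- The action of `gl(1|1)[t]` on the tensor product of `U` with the two-dimensional evaluation
module at `t = 0` on which the identity matrix acts by a variable. -/
noncomputable def twistLinear : Current →ₗ[ℂ] Matrix (Fin 2) (Fin 2) U[X] where
  toFun Y := twist X (CAlgHom (R := ℂ) (toU (evenPart Y))) (CAlgHom (R := ℂ) (toU (oddPart Y)))
    (atZero Y)
  map_add' Y Z := by simp only [map_add, twist_add]
  map_smul' c Y := by simp only [map_smul, atZero_smul, twist_smul, RingHom.id_apply]

lemma superBracket_even_even (a b c d : Polynomial ℂ) :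
    superBracket 0 0 !![a, 0; 0, b] !![c, 0; 0, d] = 0 := by
  simp [superBracket, sgn, mul_comm]

lemma superBracket_even_odd (a b c d : Polynomial ℂ) :
    superBracket 0 1 !![a, 0; 0, b] !![0, c; d, 0] = !![0, (a - b) * c; (b - a) * d, 0] := by
  ext i j : 1
  fin_cases i <;> fin_cases j <;> simp [superBracket, sgn] <;> ring

lemma superBracket_odd_even (a b c d : Polynomial ℂ) :
    superBracket 1 0 !![0, c; d, 0] !![a, 0; 0, b] = -!![0, (a - b) * c; (b - a) * d, 0] := by
  ext i j : 1
  fin_cases i <;> fin_cases j <;> simp [superBracket, sgn] <;> ring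

lemma superBracket_odd_odd (a b c d : Polynomial ℂ) :
    superBracket 1 1 !![0, a; b, 0] !![0, c; d, 0] =
      !![a * d + b * c, 0; 0, a * d + b * c] := by
  ext i j : 1
  fin_cases i <;> fin_cases j <;> simp [superBracket, sgn, ZMod.val_one] <;> ring

lemma isHomogeneous_diag (a b : Polynomial ℂ) : IsHomogeneous 0 !![a, 0; 0, b] := by
  rw [isHomogeneous_zero_iff]
  ext i j : 1
  fin_cases i <;> fin_cases j <;> simp [oddPart]

lemma isHomogeneous_antidiag (a b : Polynomial ℂ) : IsHomogeneous 1 !![0, a; b, 0] := by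
  rw [isHomogeneous_one_iff]
  ext i j : 1
  fin_cases i <;> fin_cases j <;> simp [evenPart]

lemma IsHomogeneous.exists_eq_diag {Y : Current} (h : IsHomogeneous 0 Y) :
    ∃ a b, Y = !![a, 0; 0, b] :=
  ⟨_, _, by rw [← evenPart_add_oddPart Y, (isHomogeneous_zero_iff Y).1 h, add_zero]; rfl⟩

lemma IsHomogeneous.exists_eq_antidiag {Y : Current} (h : IsHomogeneous 1 Y) :
    ∃ a b, Y = !![0, a; b, 0] :=
  ⟨_, _, by rw [← evenPart_add_oddPart Y, (isHomogeneous_one_iff Y).1 h, zero_add]; rfl⟩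

open Polynomial in
lemma twistLinear_diag (a b : ℂ[X]) : twistLinear !![a, 0; 0, b] =
    twist X (C (toU !![a, 0; 0, b])) 0 !![a.coeff 0, 0; 0, b.coeff 0] := by
  have h1 : evenPart !![a, 0; 0, b] = !![a, 0; 0, b] := rfl
  have h2 : oddPart !![a, 0; 0, b] = 0 := (isHomogeneous_zero_iff _).1 (isHomogeneous_diag a b)
  have h3 : atZero !![a, 0; 0, b] = !![a.coeff 0, 0; 0, b.coeff 0] := by
    ext i j : 1
    fin_cases i <;> fin_cases j <;> simp [atZero]
  change twist _ _ _ _ = _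
  rw [h1, h2, h3, map_zero, map_zero]
  rfl

open Polynomial in
lemma twistLinear_antidiag (a b : ℂ[X]) : twistLinear !![0, a; b, 0] =
    twist X 0 (C (toU !![0, a; b, 0])) !![0, a.coeff 0; b.coeff 0, 0] := by
  have h1 : oddPart !![0, a; b, 0] = !![0, a; b, 0] := rfl
  have h2 : evenPart !![0, a; b, 0] = 0 :=
    (isHomogeneous_one_iff _).1 (isHomogeneous_antidiag a b)
  have h3 : atZero !![0, a; b, 0] = !![0, a.coeff 0; b.coeff 0, 0] := by
    ext i j : 1
    fin_cases i <;> fin_cases j <;> simp [atZero]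
  change twist _ _ _ _ = _
  rw [h1, h2, h3, map_zero, map_zero]
  rfl

lemma toU_even_odd (a b c d : Polynomial ℂ) :
    toU !![a, 0; 0, b] * toU !![0, c; d, 0] = toU !![0, c; d, 0] * toU !![a, 0; 0, b] +
      toU !![0, (a - b) * c; (b - a) * d, 0] := by
  rw [toU_mul 0 1 _ _ (isHomogeneous_diag a b) (isHomogeneous_antidiag c d),
    superBracket_even_odd]
  simp [sgn]

lemma toU_odd_odd (a b c d : Polynomial ℂ) :
    toU !![0, a; b, 0] * toU !![0, c; d, 0] = -(toU !![0, c; d, 0] * toU !![0, a; b, 0]) +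
      toU !![a * d + b * c, 0; 0, a * d + b * c] := by
  rw [toU_mul 1 1 _ _ (isHomogeneous_antidiag a b) (isHomogeneous_antidiag c d),
    superBracket_odd_odd]
  simp [sgn, ZMod.val_one]

lemma toU_even_even (a b c d : Polynomial ℂ) :
    toU !![a, 0; 0, b] * toU !![c, 0; 0, d] = toU !![c, 0; 0, d] * toU !![a, 0; 0, b] := by
  rw [toU_mul 0 0 _ _ (isHomogeneous_diag a b) (isHomogeneous_diag c d),
    superBracket_even_even]
  simp [sgn]

open Polynomial in
lemma twistLinear_even_odd (a b c d : ℂ[X]) :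
    twistLinear !![a, 0; 0, b] * twistLinear !![0, c; d, 0] =
      twistLinear !![0, c; d, 0] * twistLinear !![a, 0; 0, b] +
        twistLinear !![0, (a - b) * c; (b - a) * d, 0] := by
  simp only [twistLinear_diag, twistLinear_antidiag, mul_coeff_zero, coeff_sub]
  refine twist_even_odd (commute_X _) (commute_X _) ?_ _ _ _ _
  rw [← C_mul, ← C_mul, ← C_add, toU_even_odd]

open Polynomial in
lemma twistLinear_mul (p q : ZMod 2) (Y Z : Current) (hY : IsHomogeneous p Y)
    (hZ : IsHomogeneous q Z) : twistLinear Y * twistLinear Z =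
      sgn p q • (twistLinear Z * twistLinear Y) + twistLinear (superBracket p q Y Z) := by
  obtain rfl | rfl : p = 0 ∨ p = 1 := by clear hY; revert p; decide
  all_goals obtain rfl | rfl : q = 0 ∨ q = 1 := by clear hZ; revert q; decide
  · obtain ⟨a, b, rfl⟩ := hY.exists_eq_diag
    obtain ⟨c, d, rfl⟩ := hZ.exists_eq_diag
    rw [superBracket_even_even, map_zero, add_zero, twistLinear_diag, twistLinear_diag, sgn,
      ZMod.val_zero, zero_mul, pow_zero, one_smul]
    refine twist_even_even (commute_X _) (commute_X _) ?_ _ _ _ _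
    rw [← C_mul, ← C_mul, toU_even_even]
  · obtain ⟨a, b, rfl⟩ := hY.exists_eq_diag
    obtain ⟨c, d, rfl⟩ := hZ.exists_eq_antidiag
    rw [superBracket_even_odd, twistLinear_even_odd]
    simp [sgn]
  · obtain ⟨c, d, rfl⟩ := hY.exists_eq_antidiag
    obtain ⟨a, b, rfl⟩ := hZ.exists_eq_diag
    rw [superBracket_odd_even, twistLinear_even_odd, map_neg]
    simp [sgn]
  · obtain ⟨a, b, rfl⟩ := hY.exists_eq_antidiag
    obtain ⟨c, d, rfl⟩ := hZ.exists_eq_antidiag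
    rw [superBracket_odd_odd, twistLinear_antidiag, twistLinear_antidiag, twistLinear_diag, sgn,
      ZMod.val_one, one_mul, pow_one, neg_smul, one_smul]
    simp only [coeff_add, mul_coeff_zero]
    refine twist_odd_odd (commute_X _) (commute_X _) ?_ _ _ _ _
    rw [← C_mul, ← C_mul, ← C_neg, ← C_add, toU_odd_odd]

open Polynomial in
/-- The homomorphism `U → M₂(U[λ])` extending `twistLinear`. -/
noncomputable def twistHom : U →ₐ[ℂ] Matrix (Fin 2) (Fin 2) U[X] :=
  RingQuot.liftAlgHom ℂ ⟨TensorAlgebra.lift ℂ twistLinear, by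
    rintro _ _ ⟨p, q, Y, Z, hY, hZ⟩
    simp only [map_mul, map_add, map_smul, TensorAlgebra.lift_ι_apply]
    exact twistLinear_mul p q Y Z hY hZ⟩

lemma twistHom_mkU (v : TensorAlgebra ℂ Current) :
    twistHom (mkU v) = TensorAlgebra.lift ℂ twistLinear v :=
  RingQuot.liftAlgHom_mkAlgHom_apply ℂ _ _ _

lemma twistHom_toU (Y : Current) : twistHom (toU Y) = twistLinear Y :=
  (twistHom_mkU _).trans (TensorAlgebra.lift_ι_apply _ _)

-- The identity matrix acts by `X` on the two-dimensional module and by `c₀` on `U`.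
open Polynomial in
lemma twistHom_c₀ : twistHom c₀ = Matrix.scalar (Fin 2) (X + C c₀) := by
  have h : (1 : Current) = !![1, 0; 0, 1] := Matrix.one_fin_two
  rw [c₀_eq, twistHom_toU, h, twistLinear_diag]
  ext i j : 1
  fin_cases i <;> fin_cases j <;> simp [twist, add_comm]

/-- The specialization `λ = 0` recovers `U` in the first row. -/
lemma eval_twistHom (u : U) : (twistHom u 0 0).coeff 0 = u ∧ (twistHom u 0 1).coeff 0 = 0 := by
  obtain ⟨v, rfl⟩ := mkU_surjective u
  induction v using TensorAlgebra.induction with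
  | algebraMap r =>
    rw [AlgHom.commutes, AlgHom.commutes]
    simp [Matrix.algebraMap_matrix_apply, Polynomial.algebraMap_apply]
  | ι Y =>
    change (twistHom (toU Y) 0 0).coeff 0 = toU Y ∧ (twistHom (toU Y) 0 1).coeff 0 = 0
    rw [twistHom_toU]
    simp [twistLinear, twist, ← map_add, evenPart_add_oddPart]
  | mul a b ha hb =>
    rw [map_mul, map_mul]
    simp [Matrix.mul_apply, Fin.sum_univ_two, Polynomial.mul_coeff_zero, ha, hb]
  | add a b ha hb =>
    rw [map_add, map_add]
    simp [ha, hb]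

/-- A monic factor can be cancelled on the right even over a noncommutative coefficient ring, so the
corner entry of `twistHom u` is zero, and its constant term is `u`. -/
lemma eq_zero_of_mul_c₀_eq_zero {u : U} (h : u * c₀ = 0) : u = 0 := by
  have h1 : twistHom u * twistHom c₀ = 0 := by rw [← map_mul, h, map_zero]
  have h2 := congr_fun (congr_fun h1 0) 0
  rw [twistHom_c₀, Matrix.mul_apply, Fin.sum_univ_two] at h2
  simp only [Matrix.scalar_apply, Matrix.diagonal_apply_eq, Matrix.zero_apply, ne_eq,
    one_ne_zero, not_false_eq_true, Matrix.diagonal_apply_ne, mul_zero, add_zero] at h2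
  rw [(Polynomial.monic_X_add_C c₀).mul_left_eq_zero_iff] at h2
  rw [← (eval_twistHom u).1, h2, Polynomial.coeff_zero]

lemma numeratorRingHom_injective :
    Function.Injective (OreLocalization.numeratorRingHom : U →+* ULoc) := by
  refine OreLocalization.numeratorHom_inj ?_
  rintro _ ⟨n, rfl⟩ u hu
  change c₀ ^ n * u = 0 at hu
  rw [((show Commute c₀ u from c₀_central u).pow_left n).eq] at hu
  induction n with
  | zero => simpa using hu
  | succ n ih =>
    rw [pow_succ, ← mul_assoc] at hu
    exact ih (eq_zero_of_mul_c₀_eq_zero hu)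

/-! ### The factorization of the Berezinian in a differential ring -/

namespace PDO

open DiffRing

variable {A : Type*} [Ring A] [DiffRing A]

lemma orderLE_inverse_del_sub (a : A) : OrderLE (-1) (Ring.inverse (del - C a)) := by
  rw [sub_eq_add_neg, ← C_neg, inverse_del_add]
  exact orderLE_delAddInv _

lemma isUnit_del_sub (a : A) : IsUnit (del - C a) := by
  rw [sub_eq_add_neg, ← C_neg]
  exact isUnit_del_add (orderLE_C _)

/-- The correction `F (∂ - a)⁻¹ E` has negative order and leaves the leading term `∂` intact. -/
lemma isUnit_schur (a b E F : A) :
    IsUnit (del + C b + C F * Ring.inverse (del - C a) * C E) := by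
  rw [add_assoc]
  refine isUnit_del_add ((orderLE_C b).add ?_)
  exact (((orderLE_C F).mul (orderLE_inverse_del_sub a)).mul (orderLE_C E)).mono (by norm_num)

/-- Conjugation of `∂ - a` by `h⁻¹ F`. -/
lemma del_sub_mul_C {a b E F hi : A} (hha : Commute hi a) (hhE : Commute hi E)
    (hhF : Commute hi F) (h1 : hi * (a + b) = 1) (h2 : (a + b) * hi = 1)
    (haF : a * F = F * a + der F) (hEF : E * F + F * E = -der (a + b)) (hFF : F * F = 0) :
    (del - C a) * C (hi * F) = C (hi * F) * (del - C a + C (hi * (E * F))) := by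
  set h := a + b with hh
  have hd : der h = -(E * F + F * E) := by rw [hEF, neg_neg]
  -- Since `h'` is minus the anticommutator of `E` and `F`, it commutes with `h⁻¹`; this gives the
  -- commutative formula `(h⁻¹)' = -h⁻² h'`.
  have hhd : Commute hi (der h) := by
    rw [hd]
    exact ((hhE.mul_right hhF).add_right (hhF.mul_right hhE)).neg_right
  have hdi : der hi = -(hi * hi * der h) := by
    have h3 : der (hi * h) = 0 := by rw [h1, der_one]
    rw [leibniz] at h3
    calc der hi = der hi * h * hi := by rw [mul_assoc, h2, mul_one]
      _ = -(hi * der h * hi) := by rw [eq_neg_of_add_eq_zero_left h3, neg_mul]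
      _ = -(hi * hi * der h) := by rw [mul_assoc, ← hhd.eq, mul_assoc]
  have key : der (hi * F) - a * (hi * F) = -(hi * F * a) + hi * F * (hi * (E * F)) := by
    -- The other half of the anticommutator contributes `E F F`, which `F² = 0` removes.
    have h4 : der h * F = -(F * (E * F)) := by
      rw [hd, neg_mul, add_mul, mul_assoc, hFF, mul_zero, zero_add, mul_assoc]
    have h5 : a * (hi * F) = hi * (F * a + der F) := by
      rw [← haF, ← mul_assoc, ← hha.eq, mul_assoc]
    have h6 : hi * F * (hi * (E * F)) = hi * hi * (F * (E * F)) := by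
      rw [mul_assoc hi F, ← mul_assoc F, ← hhF.eq]
      simp only [mul_assoc]
    rw [leibniz, hdi, h5, h6, neg_mul, mul_assoc (hi * hi), h4]
    noncomm_ring
  calc (del - C a) * C (hi * F)
      = C (hi * F) * del + C (der (hi * F) - a * (hi * F)) := by
        rw [sub_mul, del_mul_C, ← C_mul, C_sub]; abel
    _ = C (hi * F) * (del - C a + C (hi * (E * F))) := by
        rw [key, C_add, C_neg, C_mul (hi * F) a, C_mul (hi * F) (hi * (E * F))]
        noncomm_ring

/-- The `1|1` Berezinian as a quotient of two operators of order one. -/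
lemma berezinian_mul {a b E F hi : A} (hha : Commute hi a) (hhE : Commute hi E)
    (hhF : Commute hi F) (h1 : hi * (a + b) = 1) (h2 : (a + b) * hi = 1)
    (haF : a * F = F * a + der F) (hEF : E * F + F * E = -der (a + b)) (hFF : F * F = 0) :
    (del - C a) * Ring.inverse (del + C b + C F * Ring.inverse (del - C a) * C E) *
      (del + C (b - hi * (F * E))) = del - C a - C (hi * (F * E)) := by
  have hP := isUnit_del_sub a
  have hK := isUnit_schur a b E F
  have hQ : IsUnit (del - C a + C (hi * (E * F))) := by
    have := isUnit_del_sub (a - hi * (E * F))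
    rwa [C_sub, ← sub_add] at this
  have hconj := del_sub_mul_C hha hhE hhF h1 h2 haF hEF hFF
  set P := del - C a with hPdef
  set Q := P + C (hi * (E * F)) with hQdef
  set K := del + C b + C F * Ring.inverse P * C E with hKdef
  -- Moving `P` past `h⁻¹F` turns it into `Q`, which cancels `Q⁻¹`.
  have hPW : P * (1 - C (hi * F) * Ring.inverse Q * C E) = P - C (hi * (F * E)) := by
    rw [mul_sub, mul_one, mul_assoc, ← mul_assoc P, hconj, mul_assoc, ← mul_assoc Q,
      Ring.mul_inverse_cancel _ hQ, one_mul, ← C_mul, mul_assoc]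
  have hMW : (C (a + b) + C F * Ring.inverse P * C E) *
      (1 - C (hi * F) * Ring.inverse Q * C E) = C (a + b) := by
    have e1 : C (a + b) * C (hi * F) = C F := by rw [← C_mul, ← mul_assoc, h2, one_mul]
    have e2 : C E * C (hi * F) = Q - P := by
      rw [← C_mul, hQdef, add_sub_cancel_left, ← mul_assoc, ← hhE.eq, mul_assoc]
    -- The resolvent identity; by `e2` the middle factor is what `E · h⁻¹F` produces between the two
    -- inverses.
    have e3 : Ring.inverse P * (Q - P) * Ring.inverse Q = Ring.inverse P - Ring.inverse Q := by
      rw [mul_sub, sub_mul, Ring.inverse_mul_cancel _ hP, one_mul, mul_assoc,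
        Ring.mul_inverse_cancel _ hQ, mul_one]
    calc _ = C (a + b) + C F * Ring.inverse P * C E
          - C (a + b) * C (hi * F) * Ring.inverse Q * C E
          - C F * (Ring.inverse P * (C E * C (hi * F)) * Ring.inverse Q) * C E := by noncomm_ring
      _ = _ := by
        rw [e1, e2, e3]
        noncomm_ring
  have hKPM : K = P + (C (a + b) + C F * Ring.inverse P * C E) := by
    rw [hKdef, hPdef, C_add]; abel
  have hKW : K * (1 - C (hi * F) * Ring.inverse Q * C E) = del + C (b - hi * (F * E)) := by
    rw [hKPM, add_mul, hPW, hMW, hPdef, C_add, C_sub]; abel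
  rw [← hKW, mul_assoc, ← mul_assoc _ K, Ring.inverse_mul_cancel _ hK, one_mul, hPW]

lemma berezinian_eq {a b E F hi : A} (hha : Commute hi a) (hhE : Commute hi E)
    (hhF : Commute hi F) (h1 : hi * (a + b) = 1) (h2 : (a + b) * hi = 1)
    (haF : a * F = F * a + der F) (hEF : E * F + F * E = -der (a + b)) (hFF : F * F = 0) :
    (del - C a) * Ring.inverse (del + C b + C F * Ring.inverse (del - C a) * C E) =
      (del - C (a + b) + C (b - hi * (F * E))) *
        Ring.inverse (del + C (b - hi * (F * E))) := by
  have h := berezinian_mul hha hhE hhF h1 h2 haF hEF hFF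
  have hu : IsUnit (del + C (b - hi * (F * E))) := isUnit_del_add (orderLE_C _)
  rw [← Ring.mul_inverse_cancel_right _ (_ * _) hu, h]
  congr 1
  rw [C_add, C_sub]
  abel

/-- The expansion of `(∂ - h + ρ) (∂ + ρ)⁻¹`. -/
lemma del_sub_add_mul_inverse (h ρ : A) :
    (del - C h + C ρ) * Ring.inverse (del + C ρ) = 1 - C h * delAddInv ρ := by
  have hu : IsUnit (del + C ρ) := isUnit_del_add (orderLE_C ρ)
  rw [show del - C h + C ρ = (del + C ρ) - C h by abel, sub_mul, Ring.mul_inverse_cancel _ hu,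
    inverse_del_add]

end PDO

/-! ### Relations between generating series -/

open DiffRing

namespace InvLaurent

variable {R : Type*} [Ring R]

@[ext] lemma ext {f g : InvLaurent R} (h : ∀ n, f.coeff n = g.coeff n) : f = g :=
  HahnSeries.ext (funext h)

/-- The identification of Laurent series with series in `x⁻¹`. -/
noncomputable def ofLaurent : LaurentSeries R →+* InvLaurent R := RingHom.id (LaurentSeries R)

lemma ofLaurent_surjective : Function.Surjective (ofLaurent : LaurentSeries R → InvLaurent R) :=
  fun f => ⟨f, rfl⟩

lemma coeff_ofLaurent (f : LaurentSeries R) (n : ℤ) :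
    (ofLaurent f).coeff n = HahnSeries.coeff f n := rfl

lemma der_ofLaurent (f : LaurentSeries R) : der (ofLaurent f) = ofLaurent (ddx f) := rfl

/-- The generating series `∑_{r ≥ 0} u_r x^(-r-1)`. -/
noncomputable def gen (u : ℕ → R) : InvLaurent R :=
  ofLaurent (HahnSeries.single (1 : ℤ) (1 : R) *
    HahnSeries.ofPowerSeries ℤ R (PowerSeries.mk u))

lemma coeff_gen (u : ℕ → R) (n : ℤ) :
    (gen u).coeff n = if 1 ≤ n then u (n - 1).toNat else 0 := by
  obtain ⟨m, rfl⟩ : ∃ m, n = m + 1 := ⟨n - 1, by ring⟩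
  rw [gen, coeff_ofLaurent, HahnSeries.coeff_single_mul_add, one_mul, PowerSeries.coeff_coe,
    add_sub_cancel_right]
  by_cases hm : m < 0
  · rw [if_pos hm, if_neg (by omega)]
  · rw [if_neg hm, if_pos (by omega), PowerSeries.coeff_mk]
    congr 1
    omega

lemma gen_mul_gen (u v : ℕ → R) : gen u * gen v =
    ofLaurent (HahnSeries.single (1 : ℤ) (1 : R) * (HahnSeries.single (1 : ℤ) (1 : R) *
      HahnSeries.ofPowerSeries ℤ R (PowerSeries.mk u * PowerSeries.mk v))) := by
  rw [gen, gen, ← map_mul, map_mul (HahnSeries.ofPowerSeries ℤ R), mul_assoc,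
    ← mul_assoc _ (HahnSeries.single (1 : ℤ) (1 : R)), ← single_mul_comm, mul_assoc]

lemma der_gen (w : ℕ → R) : der (gen w) =
    -ofLaurent (HahnSeries.single (1 : ℤ) (1 : R) * (HahnSeries.single (1 : ℤ) (1 : R) *
      HahnSeries.ofPowerSeries ℤ R (PowerSeries.mk fun m => (m + 1) • w m))) := by
  rw [gen, der_ofLaurent, ← map_neg]
  congr 1
  ext n
  -- One shift comes from the factor `x⁻¹` in `gen`, the other from differentiation.
  obtain ⟨m, rfl⟩ : ∃ m, n = m + 1 + 1 := ⟨n - 2, by ring⟩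
  rw [coeff_ddx, HahnSeries.coeff_neg, HahnSeries.coeff_single_mul_add,
    HahnSeries.coeff_single_mul_add, HahnSeries.coeff_single_mul_add, PowerSeries.coeff_coe,
    PowerSeries.coeff_coe]
  by_cases hm : m < 0
  · simp [hm]
  · lift m to ℕ using by omega
    rw [if_neg hm, if_neg hm, PowerSeries.coeff_mk, PowerSeries.coeff_mk, one_mul,
      one_mul, one_mul, Int.natAbs_natCast, ← natCast_zsmul]
    push_cast
    rfl

/-- Commutation relations of current type between the coefficients of two generating series, in
terms of the generating series at the same point. -/
lemma gen_mul_gen_add (ε : ℤ) {u v w : ℕ → R}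
    (h : ∀ i j, u i * v j + ε • (v j * u i) = w (i + j)) :
    gen u * gen v + ε • (gen v * gen u) = -der (gen w) := by
  -- Each of the `m + 1` pairs with `i + j = m` contributes the same `w m`; the factor `m + 1` is
  -- the one produced by differentiating `x^(-m-1)`.
  have hps : PowerSeries.mk u * PowerSeries.mk v + ε • (PowerSeries.mk v * PowerSeries.mk u) =
      PowerSeries.mk fun m => (m + 1) • w m := by
    ext m
    rw [map_add, map_zsmul, PowerSeries.coeff_mul, PowerSeries.coeff_mul, PowerSeries.coeff_mk,
      ← Finset.Nat.sum_antidiagonal_swap, Finset.smul_sum, ← Finset.sum_add_distrib]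
    simp only [PowerSeries.coeff_mk, Prod.fst_swap, Prod.snd_swap]
    rw [← Finset.Nat.sum_antidiagonal_swap, Finset.sum_congr rfl (g := fun _ => w m),
      Finset.sum_const, Finset.Nat.card_antidiagonal]
    intro x hx
    rw [← Finset.HasAntidiagonal.mem_antidiagonal.1 hx, ← h]
    simp
  rw [der_gen, neg_neg, ← hps, gen_mul_gen, gen_mul_gen, ← map_zsmul, ← map_add, ← mul_smul_comm,
    ← mul_smul_comm, ← mul_add, ← mul_add, map_add, map_zsmul]

lemma commute_of_coeff {f g : InvLaurent R} (h : ∀ n m, Commute (f.coeff n) (g.coeff m)) :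
    Commute f g := by
  obtain ⟨f, rfl⟩ := ofLaurent_surjective f
  obtain ⟨g, rfl⟩ := ofLaurent_surjective g
  refine Commute.map ?_ ofLaurent
  ext n
  rw [HahnSeries.coeff_mul, HahnSeries.coeff_mul]
  exact Finset.sum_equiv (Equiv.prodComm _ _)
    (fun _ ↦ Finset.swap_mem_antidiagonal.symm) fun _ _ => h _ _

/-- The series is the unit `x⁻¹` times a power series in `x⁻¹` with invertible constant term. -/
lemma isUnit_gen {u : ℕ → R} (h : IsUnit (u 0)) : IsUnit (gen u) := by
  have h1 : IsUnit (HahnSeries.single (1 : ℤ) (1 : R) : LaurentSeries R) :=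
    ⟨⟨HahnSeries.single 1 1, HahnSeries.single (-1) 1, by simp, by simp⟩, rfl⟩
  obtain ⟨c, hc⟩ := h
  have hc' : PowerSeries.constantCoeff (PowerSeries.mk u) = (c : R) := by
    rw [hc, ← PowerSeries.coeff_zero_eq_constantCoeff_apply, PowerSeries.coeff_mk]
  have h2 : IsUnit (PowerSeries.mk u) :=
    ⟨⟨_, _, PowerSeries.mul_invOfUnit _ c hc', PowerSeries.invOfUnit_mul _ c hc'⟩, rfl⟩
  exact (h1.mul (h2.map (HahnSeries.ofPowerSeries ℤ R))).map ofLaurent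

variable {S : Type*} [Ring S]

lemma coeff_map (φ : R →+* S) (f : InvLaurent R) (n : ℤ) :
    (map φ f).coeff n = φ (f.coeff n) := rfl

lemma map_injective {φ : R →+* S} (h : Function.Injective φ) : Function.Injective (map φ) :=
  fun f g hfg => ext fun n => h (by rw [← coeff_map, hfg, coeff_map])

lemma map_gen (φ : R →+* S) (u : ℕ → R) : map φ (gen u) = gen fun r => φ (u r) := by
  ext n
  rw [coeff_map, coeff_gen, coeff_gen, apply_ite φ, map_zero]

lemma map_der (φ : R →+* S) (f : InvLaurent R) : map φ (der f) = der (map φ f) := by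
  ext n
  obtain ⟨m, rfl⟩ : ∃ m, n = m + 1 := ⟨n - 1, by ring⟩
  rw [coeff_map]
  refine (congr_arg φ (coeff_ddx f m)).trans (Eq.trans ?_ (coeff_ddx (map φ f) m).symm)
  rw [map_neg, map_zsmul]
  rfl

end InvLaurent

open InvLaurent

/-! ### Relations among the series `e_ij(x)`. -/

lemma eSeries_eq_gen (i j : Fin 2) : eSeries i j = gen (e i j) := by
  ext n
  rw [coeff_gen]
  rfl

/-- The coefficients of `e_11(x) + e_22(x)`. -/
noncomputable def trE (r : ℕ) : U := e 0 0 r + e 1 1 r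

lemma eSeries_add_eq_gen : eSeries 0 0 + eSeries 1 1 = gen trE := by
  ext n
  refine Eq.trans (b := (eSeries 0 0).coeff n + (eSeries 1 1).coeff n) rfl ?_
  rw [eSeries_eq_gen, eSeries_eq_gen, coeff_gen, coeff_gen, coeff_gen]
  split_ifs
  · rfl
  · rw [add_zero]

lemma single_zero_zero (p : Polynomial ℂ) :
    (Matrix.single 0 0 p : Current) = !![p, 0; 0, 0] := by
  ext i j : 1; fin_cases i <;> fin_cases j <;> simp

lemma single_one_one (p : Polynomial ℂ) :
    (Matrix.single 1 1 p : Current) = !![0, 0; 0, p] := by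
  ext i j : 1; fin_cases i <;> fin_cases j <;> simp

lemma single_zero_one (p : Polynomial ℂ) :
    (Matrix.single 0 1 p : Current) = !![0, p; 0, 0] := by
  ext i j : 1; fin_cases i <;> fin_cases j <;> simp

lemma single_one_zero (p : Polynomial ℂ) :
    (Matrix.single 1 0 p : Current) = !![0, 0; p, 0] := by
  ext i j : 1; fin_cases i <;> fin_cases j <;> simp

lemma trE_eq (r : ℕ) :
    trE r = toU !![Polynomial.X ^ r, 0; 0, Polynomial.X ^ r] := by
  rw [trE, e, e, ← map_add, single_zero_zero, single_one_one]
  congr 1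
  ext i j : 1; fin_cases i <;> fin_cases j <;> simp

/-- The bracket with an odd matrix is governed by the difference of the diagonal entries, which is
zero for a scalar matrix. -/
lemma trE_comm_toU (r : ℕ) (Y : Current) : Commute (trE r) (toU Y) := by
  rw [← evenPart_add_oddPart Y, map_add, trE_eq]
  refine Commute.add_right (toU_even_even _ _ _ _) ?_
  refine (toU_even_odd _ _ _ _).trans ?_
  have h : (!![0, (Polynomial.X ^ r - Polynomial.X ^ r) * Y 0 1;
      (Polynomial.X ^ r - Polynomial.X ^ r) * Y 1 0, 0] : Current) = 0 := by
    ext i j : 1; fin_cases i <;> fin_cases j <;> simp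
  rw [h, map_zero, add_zero]
  rfl

lemma trE_central (r : ℕ) (u : U) : Commute (trE r) u := by
  obtain ⟨v, rfl⟩ := mkU_surjective u
  induction v using TensorAlgebra.induction with
  | algebraMap c =>
    rw [AlgHom.commutes]
    exact (Algebra.commutes c _).symm
  | ι x => exact trE_comm_toU r x
  | mul a b ha hb => rw [map_mul]; exact ha.mul_right hb
  | add a b ha hb => rw [map_add]; exact ha.add_right hb

lemma eSeries_add_central (f : InvLaurent U) : Commute (eSeries 0 0 + eSeries 1 1) f := by
  rw [eSeries_add_eq_gen]
  refine commute_of_coeff fun n m => ?_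
  rw [coeff_gen]
  split_ifs
  · exact trE_central _ _
  · exact Commute.zero_left _

lemma eSeries_one_zero_mul_self : eSeries 1 0 * eSeries 1 0 = 0 := by
  have h : ∀ i j, e 1 0 i * e 1 0 j + (1 : ℤ) • (e 1 0 j * e 1 0 i) = 0 := by
    intro i j
    rw [e, e, single_one_zero, single_one_zero, toU_odd_odd]
    have h0 : (!![0, 0; 0, 0] : Current) = 0 := by
      ext i j : 1; fin_cases i <;> fin_cases j <;> rfl
    simp [h0]
  have h2 := gen_mul_gen_add (w := fun _ => 0) 1 h
  have h3 : gen (fun _ => (0 : U)) = 0 := by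
    ext n
    rw [coeff_gen, ite_self]
    rfl
  rw [h3, map_zero, neg_zero, one_smul, ← eSeries_eq_gen] at h2
  ext n
  have h4 : (eSeries 1 0 * eSeries 1 0).coeff n + (eSeries 1 0 * eSeries 1 0).coeff n = 0 :=
    congr_arg (fun f : InvLaurent U => f.coeff n) h2
  -- The anticommutator of `e_21(x)` with itself gives only `2 F² = 0`; the complex structure of `U`
  -- allows division by two.
  rw [← two_smul ℂ] at h4
  exact (smul_eq_zero_iff_right (two_ne_zero)).1 h4

lemma eSeries_zero_zero_mul : eSeries 0 0 * eSeries 1 0 =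
    eSeries 1 0 * eSeries 0 0 + der (eSeries 1 0) := by
  have h : ∀ i j, e 0 0 i * e 1 0 j + (-1 : ℤ) • (e 1 0 j * e 0 0 i) = -e 1 0 (i + j) := by
    intro i j
    rw [e, e, e, single_zero_zero, single_one_zero, single_one_zero, toU_even_odd, ← map_neg]
    have h0 : (!![0, (Polynomial.X ^ i - 0) * 0; (0 - Polynomial.X ^ i) * Polynomial.X ^ j, 0] :
        Current) = -!![0, 0; Polynomial.X ^ (i + j), 0] := by
      ext i j : 1; fin_cases i <;> fin_cases j <;> simp [pow_add]
    rw [h0, neg_smul, one_smul]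
    abel
  have h2 := gen_mul_gen_add (w := fun r => -e 1 0 r) (-1) h
  have h3 : gen (fun r => -e 1 0 r) = -gen (e 1 0) := by
    ext n
    refine Eq.trans ?_ (Eq.symm (b := -(gen (e 1 0)).coeff n) rfl)
    rw [coeff_gen, coeff_gen]
    split_ifs <;> simp
  rw [h3, map_neg, neg_neg, neg_smul, one_smul, ← eSeries_eq_gen, ← eSeries_eq_gen] at h2
  rw [← h2]
  abel

lemma eSeries_anticommutator : eSeries 0 1 * eSeries 1 0 + eSeries 1 0 * eSeries 0 1 =
    -der (eSeries 0 0 + eSeries 1 1) := by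
  have h : ∀ i j, e 0 1 i * e 1 0 j + (1 : ℤ) • (e 1 0 j * e 0 1 i) = trE (i + j) := by
    intro i j
    rw [e, e, single_zero_one, single_one_zero, toU_odd_odd, trE_eq]
    simp [pow_add]
  have h2 := gen_mul_gen_add 1 h
  rwa [one_smul, ← eSeries_add_eq_gen, ← eSeries_eq_gen, ← eSeries_eq_gen] at h2

/-! ### The Berezinian of `gl(1|1)[t]` -/

open DiffRing InvLaurent

lemma Z_zero_zero : Z 0 0 = PDO.del - PDO.C (eSeries 0 0) := by
  simp [Z]

lemma Z_schur : Z 1 1 - Z 1 0 * Ring.inverse (Z 0 0) * Z 0 1 =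
    PDO.del + PDO.C (eSeries 1 1) + PDO.C (eSeries 1 0) *
      Ring.inverse (PDO.del - PDO.C (eSeries 0 0)) * PDO.C (eSeries 0 1) := by
  simp [Z, PDO.C_neg]

lemma isUnit_Z_zero_zero : IsUnit (Z 0 0) := by
  rw [Z_zero_zero]
  exact PDO.isUnit_del_sub _

lemma isUnit_Z_schur : IsUnit (Z 1 1 - Z 1 0 * Ring.inverse (Z 0 0) * Z 0 1) := by
  rw [Z_schur]
  exact PDO.isUnit_schur _ _ _ _

/-! ### Passage to the localization and the transfer matrices. -/

lemma loc_injective : Function.Injective loc := InvLaurent.map_injective numeratorRingHom_injective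

lemma loc_der (f : InvLaurent U) : loc (der f) = der (loc f) := InvLaurent.map_der _ f

lemma isUnit_loc_trace : IsUnit (loc (eSeries 0 0 + eSeries 1 1)) := by
  rw [eSeries_add_eq_gen, loc, map_gen]
  -- The leading coefficient `trE 0` is `c₀` by definition.
  exact isUnit_gen (OreLocalization.numerator_isUnit
    (⟨c₀, Submonoid.mem_powers c₀⟩ : Submonoid.powers c₀))

/-- The inverse of `e_11(x) + e_22(x)` over the localization. -/
noncomputable def traceInv : InvLaurent ULoc := Ring.inverse (loc (eSeries 0 0 + eSeries 1 1))

lemma traceInv_commute (f : InvLaurent U) : Commute traceInv (loc f) := by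
  obtain ⟨u, hu⟩ := isUnit_loc_trace
  have h : Commute (u : InvLaurent ULoc) (loc f) := by
    rw [hu]
    exact Commute.map (eSeries_add_central f) loc
  rw [traceInv, ← hu, Ring.inverse_unit]
  exact h.units_inv_left

/-- The series `e_22(x) - (e_11(x) + e_22(x))⁻¹ e_21(x) e_12(x)`. -/
noncomputable def rho : InvLaurent ULoc :=
  loc (eSeries 1 1) - traceInv * (loc (eSeries 1 0) * loc (eSeries 0 1))

/-- The universal formula for the Berezinian, with an explicit `ρ`. -/
lemma map_D : D.map loc = (PDO.del - PDO.C (loc (eSeries 0 0 + eSeries 1 1)) + PDO.C rho) *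
    Ring.inverse (PDO.del + PDO.C rho) := by
  have h := PDO.berezinian_eq (a := loc (eSeries 0 0)) (b := loc (eSeries 1 1))
    (E := loc (eSeries 0 1)) (F := loc (eSeries 1 0)) (hi := traceInv)
    (traceInv_commute _) (traceInv_commute _) (traceInv_commute _)
    (by rw [← map_add]; exact Ring.inverse_mul_cancel _ isUnit_loc_trace)
    (by rw [← map_add]; exact Ring.mul_inverse_cancel _ isUnit_loc_trace)
    (by rw [← map_mul, eSeries_zero_zero_mul, map_add, map_mul, loc_der])
    (by rw [← map_mul, ← map_mul, ← map_add, eSeries_anticommutator, map_neg, loc_der, map_add])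
    (by rw [← map_mul, eSeries_one_zero_mul_self, map_zero])
  rw [← map_add] at h
  rw [rho, ← h, D_eq, ← PDO.mapHom_apply loc loc_der, map_mul,
    map_ringInverse _ (PDO.isUnit_schur _ _ _ _), map_add, map_add, map_mul, map_mul,
    map_ringInverse _ (PDO.isUnit_del_sub _), map_sub]
  simp only [PDO.mapHom_C, PDO.mapHom_del]

/-- This is `1 - h (∂ + ρ)⁻¹` read coefficientwise. The order bound, `G_0` and all later transfer
matrices follow from it, with `loc_injective` bringing identities back to `U`. -/
lemma loc_coeff_D (n : ℤ) : loc (D.coeff n) =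
    (1 : PDO (InvLaurent ULoc)).coeff n -
      loc (eSeries 0 0 + eSeries 1 1) * (PDO.delAddInv rho).coeff n := by
  rw [← PDO.coeff_map, map_D, PDO.del_sub_add_mul_inverse, PDO.coeff_sub, PDO.coeff_C_mul]

lemma coeff_D_of_pos {n : ℤ} (hn : 0 < n) : D.coeff n = 0 := by
  refine loc_injective ?_
  rw [loc_coeff_D, PDO.coeff_one, if_neg (by omega), PDO.orderLE_delAddInv _ _ (by omega),
    mul_zero, sub_zero, map_zero]

lemma G_zero : G 0 = 1 := by
  refine loc_injective ?_
  rw [G, pow_zero, one_mul, loc_coeff_D, PDO.coeff_one, if_pos (by simp),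
    PDO.orderLE_delAddInv _ _ (by simp), mul_zero, sub_zero, map_one]

lemma loc_G_succ_eq (r : ℕ) : loc (G (r + 1)) =
    loc (eSeries 0 0 + eSeries 1 1) * (fun h => der h + rho * h)^[r] 1 := by
  rw [G, map_mul, loc_coeff_D, PDO.coeff_one, if_neg (by omega),
    show -((r + 1 : ℕ) : ℤ) = -(r : ℤ) - 1 by push_cast; ring, PDO.coeff_delAddInv, map_pow,
    map_neg, map_one, pow_succ]
  set x := (fun h => der h + rho * h)^[r] 1
  -- The sign `(-1)^(r+1)` in `G`, the minus sign in `1 - h (∂ + ρ)⁻¹` and the sign `(-1)^r` of its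
  -- coefficient cancel.
  rcases Nat.even_or_odd r with h | h <;> simp [h.neg_one_pow]

lemma G_one : G 1 = eSeries 0 0 + eSeries 1 1 :=
  loc_injective <| by rw [loc_G_succ_eq 0, Function.iterate_zero, id, mul_one]

/-- The case `r = 1` gives `G_2 = hρ`, and `h⁻¹` commutes with `ρ`. -/
lemma ratio_eq : ratio = rho := by
  have h : Commute traceInv rho :=
    (traceInv_commute _).sub_right ((Commute.refl _).mul_right
      ((traceInv_commute _).mul_right (traceInv_commute _)))
  rw [ratio, G_one, loc_G_succ_eq 1]
  change _ * traceInv = _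
  simp only [Function.iterate_one, der_one, zero_add, mul_one]
  rw [mul_assoc, ← h.eq, traceInv, Ring.mul_inverse_cancel_left _ _ isUnit_loc_trace]

end Gaudin

theorem corollary4p9 :
    -- the Berezinian is well defined: both operators inverted in it are invertible
    IsUnit (Z 0 0) ∧
    IsUnit (Z 1 1 - Z 1 0 * Ring.inverse (Z 0 0) * Z 0 1) ∧
    -- it has an expansion `∑_{r ≥ 0} (-1)^r G_r(x) ∂_x^(-r)` with `G_0 = 1`
    (∀ n : ℤ, 0 < n → D.coeff n = 0) ∧
    G 0 = 1 ∧
    -- division by `G_1` makes sense: `G_1` is central, passing to the localization loses nothing,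
    -- and `G_1` becomes invertible there
    (∀ a : InvLaurent U, Commute (G 1) a) ∧
    Function.Injective loc ∧
    IsUnit (loc (G 1)) ∧
    -- the universal formula for the Berezinian
    IsUnit (PDO.del + PDO.C ratio) ∧
    D.map loc = (PDO.del - PDO.C (loc (G 1)) + PDO.C ratio) *
      Ring.inverse (PDO.del + PDO.C ratio) ∧
    -- all transfer matrices through the first two
    ∀ r : ℕ, loc (G (r + 1)) =
      loc (G 1) * (fun h => DiffRing.der h + ratio * h)^[r] 1 := by
  refine ⟨isUnit_Z_zero_zero, isUnit_Z_schur, fun n hn => coeff_D_of_pos hn, G_zero, ?_,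
    loc_injective, ?_, PDO.isUnit_del_add (PDO.orderLE_C _), ?_, fun r => ?_⟩
  · rw [G_one]
    exact eSeries_add_central
  · rw [G_one]
    exact isUnit_loc_trace
  · rw [G_one, ratio_eq]
    exact map_D
  · rw [G_one, ratio_eq]
    exact loc_G_succ_eq r
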